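/- Let $n\ge 2$ be an integer and let $\mathcal O_n$ be the Cuntz algebra, i.e. the universal unital $C^*$-algebra generated by isometries $S_1,\dots,S_n$ with $\sum_{i=1}^n S_iS_i^*=1$. For a finite word $\mu=(\mu_1,\dots,\mu_k)$ in $\{1,\dots,n\}$ put $S_\mu=S_{\mu_1}\cdots S_{\mu_k}$ and $P_\mu=S_\mu S_\mu^*$. Let $\mathcal D_n$ be the $C^*$-subalgebra generated by all $P_\mu$, let $\mathcal F_n$ be the $C^*$-subalgebra generated by all $S_\mu S_\nu^*$ with $|\mu|=|\nu|$, and let $\mathcal P_n$ be the group of unitaries of $\mathcal F_n$ that are finite sums of words $S_\mu S_\nu^*$. An automorphism of $\mathcal O_n$ is called permutative if it is of the form $\lambda_u$, $\lambda_u(S_i)=uS_i$ $(i=1,\dots,n)$, with $u\in\mathcal P_n$. The permutative automorphisms form a group $\lambda(\mathcal P_n)^{-1}$, which contains the normal subgroup $\operatorname{Inn}\lambda(\mathcal P_n)^{-1}=\{\operatorname{Ad}(u):u\in\mathcal P_n\}$. Let $X_n=\{1,\dots,n\}^{\mathbb N}$ be the full one-sided $n$-shift space and $\operatorname{Aut}(X_n)$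 the group of homeomorphisms of $X_n$ that commute with the shift. There is a $*$-isomorphism $C(X_n)\cong\mathcal D_n$ which takes, for every word $\mu$, the characteristic function of the cylinder set of all sequences beginning with $\mu$ to $P_\mu$. Through it, $f\in\operatorname{Aut}(X_n)$ is viewed as the automorphism $g\mapsto g\circ f^{-1}$ of $\mathcal D_n$. Then: (a) every $f\in\operatorname{Aut}(X_n)$ extends to a unique permutative automorphism $\beta_f$ of $\mathcal O_n$, and if $f\neq\mathrm{id}$ then $\beta_f$ is outer, i.e. not of the form $\operatorname{Ad}(u)$ with $u$ a unitary of $\mathcal O_n$; (b) the map $f\mapsto[\beta_f]$ is an injective group homomorphism from $\operatorname{Aut}(X_n)$ into the restricted outer Weyl group $\lambda(\mathcal P_n)^{-1}/\operatorname{Inn}\lambda(\mathcal P_n)^{-1}$. -/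

import Mathlib

noncomputable section

open scoped ENNReal

/-! ### The Cuntz algebra -/

/-- A Cuntz family in a (nonzero) unital C⋆-algebra: `n` isometries whose range projections
add up to the unit. -/
structure CuntzFamily (n : ℕ) : Type 1 where
  /-- The ambient C⋆-algebra. -/
  carrier : Type
  [cstar : CStarAlgebra carrier]
  [nontriv : Nontrivial carrier]
  /-- The isometries. -/
  gen : Fin n → carrier
  star_mul_self : ∀ i, star (gen i) * gen i = 1
  sum_range : ∑ i, gen i * star (gen i) = 1

attribute [instance] CuntzFamily.cstar CuntzFamily.nontriv

/-- The C⋆-algebra of bounded families indexed by all Cuntz families. -/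
abbrev CuntzAmbient (n : ℕ) : Type 1 := lp (fun ρ : CuntzFamily n => ρ.carrier) ∞

instance CuntzAmbient.instCStarAlgebra (n : ℕ) : CStarAlgebra (CuntzAmbient n) where

theorem CuntzFamily.norm_gen_le {n : ℕ} (ρ : CuntzFamily n) (i : Fin n) : ‖ρ.gen i‖ ≤ 1 := by
  have h : ‖ρ.gen i‖ * ‖ρ.gen i‖ = 1 := by
    rw [← CStarRing.norm_star_mul_self, ρ.star_mul_self i, norm_one]
  nlinarith [norm_nonneg (ρ.gen i)]

/-- The direct sum of the `i`-th isometries of all Cuntz families. -/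
def CuntzAmbient.gen (n : ℕ) (i : Fin n) : CuntzAmbient n :=
  ⟨fun ρ => ρ.gen i, memℓp_infty ⟨1, by rintro _ ⟨ρ, rfl⟩; exact ρ.norm_gen_le i⟩⟩

/-- The C⋆-subalgebra generated by the direct sums of the isometries of all Cuntz families. -/
def cuntzSubalgebra (n : ℕ) : StarSubalgebra ℂ (CuntzAmbient n) :=
  (StarAlgebra.adjoin ℂ (Set.range (CuntzAmbient.gen n))).topologicalClosure

instance cuntzSubalgebra.isClosed (n : ℕ) : IsClosed (cuntzSubalgebra n : Set (CuntzAmbient n)) :=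
  StarSubalgebra.isClosed_topologicalClosure _

/-- The Cuntz algebra `𝒪ₙ`: the universal unital C⋆-algebra generated by `n` isometries
`S₁, …, Sₙ` with `∑ Sᵢ Sᵢ* = 1` (see `CuntzAlgebra.star_gen_mul_gen_self`,
`CuntzAlgebra.sum_gen_mul_star_gen`, `CuntzAlgebra.adjoin_gen` and
`CuntzAlgebra.existsUnique_hom`). Algebras generated by such isometries are separable, so that the
families in C⋆-algebras of the lowest universe are all families up to isomorphism. -/
def CuntzAlgebra (n : ℕ) : Type 1 := cuntzSubalgebra n

instance CuntzAlgebra.instCStarAlgebra (n : ℕ) : CStarAlgebra (CuntzAlgebra n) :=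
  inferInstanceAs (CStarAlgebra (cuntzSubalgebra n))

namespace CuntzAlgebra

variable {n : ℕ}

/-- The generating isometries of `𝒪ₙ`. -/
def gen (i : Fin n) : CuntzAlgebra n :=
  (⟨CuntzAmbient.gen n i, StarSubalgebra.le_topologicalClosure _
    (StarAlgebra.subset_adjoin ℂ _ ⟨i, rfl⟩)⟩ : cuntzSubalgebra n)

/-- The inclusion of `𝒪ₙ` in the direct sum. -/
def incl (n : ℕ) : CuntzAlgebra n →⋆ₐ[ℂ] CuntzAmbient n := (cuntzSubalgebra n).subtype

theorem incl_injective : Function.Injective (incl n) := Subtype.val_injective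

theorem incl_gen (i : Fin n) : incl n (gen i) = CuntzAmbient.gen n i := rfl

theorem star_gen_mul_gen_self (i : Fin n) : star (gen i) * gen i = 1 := by
  apply incl_injective
  rw [map_mul, map_star, map_one, incl_gen]
  ext ρ
  exact ρ.star_mul_self i

theorem sum_gen_mul_star_gen : ∑ i : Fin n, gen i * star (gen i) = 1 := by
  apply incl_injective
  simp only [map_sum, map_mul, map_star, map_one, incl_gen]
  ext ρ
  rw [lp.coeFn_sum, Finset.sum_apply]
  exact ρ.sum_range

theorem adjoin_gen :
    (StarAlgebra.adjoin ℂ (Set.range (gen : Fin n → CuntzAlgebra n))).topologicalClosure = ⊤ := by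
  rw [eq_top_iff]
  rintro x -
  have hx : incl n x ∈ (StarAlgebra.adjoin ℂ (Set.range (CuntzAmbient.gen n))).topologicalClosure :=
    Subtype.property x
  have hmap : (StarAlgebra.adjoin ℂ (Set.range (gen : Fin n → CuntzAlgebra n))).map (incl n)
      = StarAlgebra.adjoin ℂ (Set.range (CuntzAmbient.gen n)) := by
    rw [StarAlgHom.map_adjoin, ← Set.range_comp]; rfl
  have hind : Topology.IsInducing (incl n) := Topology.IsInducing.subtypeVal
  change x ∈ closure _
  rw [hind.closure_eq_preimage_closure_image]
  change incl n x ∈ closure _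
  rw [← StarSubalgebra.coe_map, hmap]
  exact hx

open scoped CStarAlgebra in
/-- The universal property of `𝒪ₙ`. -/
theorem existsUnique_hom (B : Type) [CStarAlgebra B] [Nontrivial B] (T : Fin n → B)
    (hT : ∀ i, star (T i) * T i = 1) (hsum : ∑ i, T i * star (T i) = 1) :
    ∃! π : CuntzAlgebra n →⋆ₐ[ℂ] B, ∀ i, π (gen i) = T i := by
  let ρ : CuntzFamily n := ⟨B, T, hT, hsum⟩
  let ev : CuntzAmbient n →⋆ₐ[ℂ] B :=
    { toFun := fun x => x ρ
      map_one' := rfl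
      map_mul' := fun _ _ => rfl
      map_zero' := rfl
      map_add' := fun _ _ => rfl
      commutes' := fun _ => rfl
      map_star' := fun _ => rfl }
  refine ⟨ev.comp (incl n), fun i => rfl, fun π hπ => ?_⟩
  have hc : (⊤ : StarSubalgebra ℂ (CuntzAlgebra n)) ≤ StarAlgHom.equalizer π (ev.comp (incl n)) := by
    rw [← adjoin_gen]
    refine StarSubalgebra.topologicalClosure_minimal (StarAlgebra.adjoin_le ?_) ?_
    · rintro _ ⟨i, rfl⟩
      exact hπ i
    · exact isClosed_eq (map_continuous π) (map_continuous (ev.comp (incl n)))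
  ext x
  exact hc (x := x) trivial

theorem star_gen_mul_gen_of_ne {i j : Fin n} (hij : i ≠ j) :
    star (gen i) * gen j = (0 : CuntzAlgebra n) := by
  let _ : PartialOrder (CuntzAlgebra n) := CStarAlgebra.spectralOrder _
  have _ : StarOrderedRing (CuntzAlgebra n) := CStarAlgebra.spectralOrderedRing _
  have h1 : ∑ k : Fin n, star (star (gen k) * gen j) * (star (gen k) * gen j)
      = (1 : CuntzAlgebra n) := by
    calc _ = star (gen j) * (∑ k : Fin n, gen k * star (gen k)) * gen j := by
          simp [Finset.mul_sum, Finset.sum_mul, mul_assoc]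
      _ = 1 := by rw [sum_gen_mul_star_gen, mul_one, star_gen_mul_gen_self]
  rw [← Finset.add_sum_erase _ _ (Finset.mem_univ j), star_gen_mul_gen_self, star_one,
    one_mul, add_eq_left, Finset.sum_eq_zero_iff_of_nonneg (fun _ _ => star_mul_self_nonneg _)] at h1
  exact CStarRing.star_mul_self_eq_zero_iff _ |>.1 (h1 i (by simp [hij]))

/-! ### Words, the core and the diagonal -/

/-- `S_μ = S_{μ₁} ⋯ S_{μ_k}`. -/
def word (μ : List (Fin n)) : CuntzAlgebra n := (μ.map gen).prod

/-- The range projection `P_μ = S_μ S_μ*`. -/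
def rangeProj (μ : List (Fin n)) : CuntzAlgebra n := word μ * star (word μ)

/-- The core UHF-subalgebra `ℱₙ`: the C⋆-subalgebra generated by the words
`S_μ S_ν*` with `|μ| = |ν|`. -/
def core (n : ℕ) : StarSubalgebra ℂ (CuntzAlgebra n) :=
  (StarAlgebra.adjoin ℂ {x | ∃ μ ν : List (Fin n), μ.length = ν.length ∧
    x = word μ * star (word ν)}).topologicalClosure

/-- The diagonal `𝒟ₙ`: the C⋆-subalgebra generated by the projections `P_μ`. -/
def diagonal (n : ℕ) : StarSubalgebra ℂ (CuntzAlgebra n) :=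
  (StarAlgebra.adjoin ℂ (Set.range (rangeProj : List (Fin n) → CuntzAlgebra n))).topologicalClosure

/-- Finite sums of words `S_{μ_j} S_{ν_j}*`. -/
def IsWordSum (x : CuntzAlgebra n) : Prop :=
  ∃ L : List (List (Fin n) × List (Fin n)), x = (L.map fun p => word p.1 * star (word p.2)).sum

theorem word_nil : word ([] : List (Fin n)) = 1 := rfl

theorem word_cons (i : Fin n) (μ : List (Fin n)) : word (i :: μ) = gen i * word μ := by
  simp [word]

theorem word_append (μ ν : List (Fin n)) : word (μ ++ ν) = word μ * word ν := by
  simp [word]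

theorem isWordSum_word (μ ν : List (Fin n)) : IsWordSum (word μ * star (word ν)) :=
  ⟨[(μ, ν)], by simp⟩

theorem isWordSum_zero : IsWordSum (0 : CuntzAlgebra n) := ⟨[], by simp⟩

theorem isWordSum_one : IsWordSum (1 : CuntzAlgebra n) := by
  simpa [word_nil] using isWordSum_word ([] : List (Fin n)) []

theorem IsWordSum.add {x y : CuntzAlgebra n} : IsWordSum x → IsWordSum y → IsWordSum (x + y) := by
  rintro ⟨L, rfl⟩ ⟨M, rfl⟩
  exact ⟨L ++ M, by simp⟩

theorem isWordSum_list_sum (l : List (CuntzAlgebra n)) (h : ∀ x ∈ l, IsWordSum x) :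
    IsWordSum l.sum := by
  induction l with
  | nil => simpa using isWordSum_zero
  | cons a l ih =>
    rw [List.sum_cons]
    exact (h a (by simp)).add (ih fun x hx => h x (by simp [hx]))

theorem isWordSum_finset_sum {ι : Type*} (s : Finset ι) (f : ι → CuntzAlgebra n)
    (h : ∀ x ∈ s, IsWordSum (f x)) : IsWordSum (∑ i ∈ s, f i) :=
  Finset.sum_induction f IsWordSum (fun _ _ => IsWordSum.add) isWordSum_zero h

theorem IsWordSum.star {x : CuntzAlgebra n} : IsWordSum x → IsWordSum (star x) := by
  rintro ⟨L, rfl⟩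
  induction L with
  | nil => simpa using isWordSum_zero
  | cons p L ih =>
    rw [List.map_cons, List.sum_cons, star_add]
    refine IsWordSum.add ?_ ih
    simpa using isWordSum_word p.2 p.1

/-- The reduction of `S_ν* S_α`. -/
theorem star_word_mul_word (ν α : List (Fin n)) :
    (∃ γ, star (word ν) * word α = word γ) ∨ (∃ γ, star (word ν) * word α = star (word γ)) ∨
      star (word ν) * word α = 0 := by
  induction ν generalizing α with
  | nil => exact Or.inl ⟨α, by simp [word_nil]⟩
  | cons i ν ih =>
    cases α with
    | nil => exact Or.inr (Or.inl ⟨i :: ν, by simp [word_nil]⟩)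
    | cons j α =>
      have h : star (word (i :: ν)) * word (j :: α)
          = star (word ν) * (star (gen i) * gen j) * word α := by
        simp [word_cons, mul_assoc]
      by_cases hij : i = j
      · subst hij
        rw [h, star_gen_mul_gen_self, mul_one]
        exact ih α
      · rw [h, star_gen_mul_gen_of_ne hij]
        simp

theorem isWordSum_word_mul (μ ν α β : List (Fin n)) :
    IsWordSum (word μ * star (word ν) * (word α * star (word β))) := by
  have h : word μ * star (word ν) * (word α * star (word β))
      = word μ * (star (word ν) * word α) * star (word β) := by simp only [mul_assoc]
  rw [h]
  rcases star_word_mul_word ν α with ⟨γ, hγ⟩ | ⟨γ, hγ⟩ | hγ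
  · rw [hγ, ← word_append]
    exact isWordSum_word _ _
  · rw [hγ, mul_assoc, ← star_mul, ← word_append]
    exact isWordSum_word _ _
  · rw [hγ]
    simpa using isWordSum_zero

theorem IsWordSum.mul {x y : CuntzAlgebra n} : IsWordSum x → IsWordSum y → IsWordSum (x * y) := by
  rintro ⟨L, rfl⟩ ⟨M, rfl⟩
  rw [← List.sum_map_mul_right]
  refine isWordSum_list_sum _ fun x hx => ?_
  obtain ⟨p, -, rfl⟩ := List.mem_map.1 hx
  rw [← List.sum_map_mul_left]
  refine isWordSum_list_sum _ fun y hy => ?_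
  obtain ⟨q, -, rfl⟩ := List.mem_map.1 hy
  exact isWordSum_word_mul _ _ _ _

theorem isWordSum_gen (i : Fin n) : IsWordSum (gen i) := by
  simpa [word_nil, word_cons] using isWordSum_word [i] []

/-- `𝒮ₙ`: the unitaries of `𝒪ₙ` that are finite sums of words. -/
def wordUnitaries (n : ℕ) : Subgroup (unitary (CuntzAlgebra n)) where
  carrier := {u | IsWordSum (u : CuntzAlgebra n)}
  mul_mem' := fun h₁ h₂ => IsWordSum.mul h₁ h₂
  one_mem' := isWordSum_one
  inv_mem' := fun h => IsWordSum.star h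

/-- `𝒫ₙ = 𝒮ₙ ∩ 𝒰(ℱₙ)`. -/
def permUnitaries (n : ℕ) : Subgroup (unitary (CuntzAlgebra n)) where
  carrier := {u | u ∈ wordUnitaries n ∧ (u : CuntzAlgebra n) ∈ core n}
  mul_mem' := fun h₁ h₂ => ⟨mul_mem h₁.1 h₂.1, mul_mem h₁.2 h₂.2⟩
  one_mem' := ⟨one_mem _, one_mem (core n)⟩
  inv_mem' := fun h => ⟨inv_mem h.1, star_mem h.2⟩

/-! ### The restricted outer Weyl group -/

/-- The group of ⋆-automorphisms of `𝒪ₙ`. -/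
abbrev Aut (n : ℕ) : Type 1 := CuntzAlgebra n ≃⋆ₐ[ℂ] CuntzAlgebra n

/-- `Ad u`. -/
abbrev Ad : unitary (CuntzAlgebra n) →* Aut n := Unitary.conjStarAlgAut ℂ (CuntzAlgebra n)

/-- `α` is the automorphism `λ_u`, i.e. `α(Sᵢ) = u Sᵢ` for all `i`, for some `u ∈ 𝒫ₙ`. -/
def IsPermutative (α : Aut n) : Prop :=
  ∃ u ∈ permUnitaries n, ∀ i, α (gen i) = u * gen i

/-- `α` is outer: it is not of the form `Ad u` with `u` a unitary of `𝒪ₙ`. -/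
def IsOuter (α : Aut n) : Prop := ∀ u : unitary (CuntzAlgebra n), α ≠ Ad u

theorem word_mem_core {μ ν : List (Fin n)} (h : μ.length = ν.length) :
    word μ * star (word ν) ∈ core n :=
  StarSubalgebra.le_topologicalClosure _ (StarAlgebra.subset_adjoin ℂ _ ⟨μ, ν, h, rfl⟩)

theorem gen_mul_mul_star_gen_mem_core {x : CuntzAlgebra n} (hx : x ∈ core n) (i j : Fin n) :
    gen i * x * star (gen j) ∈ core n := by
  have key : ∀ y ∈ StarAlgebra.adjoin ℂ {x | ∃ μ ν : List (Fin n), μ.length = ν.length ∧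
      x = word μ * star (word ν)}, ∀ i j, gen i * y * star (gen j) ∈ core n := by
    intro y hy
    induction hy using StarAlgebra.adjoin_induction with
    | mem y hy =>
      obtain ⟨μ, ν, h, rfl⟩ := hy
      intro i j
      have : gen i * (word μ * star (word ν)) * star (gen j)
          = word (i :: μ) * star (word (j :: ν)) := by simp [word_cons, mul_assoc]
      rw [this]
      exact word_mem_core (by simp [h])
    | algebraMap r =>
      intro i j
      have : gen i * algebraMap ℂ (CuntzAlgebra n) r * star (gen j)
          = r • (word [i] * star (word [j])) := by
        simp [word_cons, word_nil, Algebra.algebraMap_eq_smul_one]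
      rw [this]
      exact (core n).smul_mem (word_mem_core (μ := [i]) (ν := [j]) rfl) r
    | add y z _ _ hy hz =>
      intro i j
      rw [mul_add, add_mul]
      exact add_mem (hy i j) (hz i j)
    | mul y z _ _ hy hz =>
      intro i j
      have : gen i * (y * z) * star (gen j)
          = gen i * y * star (gen i) * (gen i * z * star (gen j)) := by
        have h := star_gen_mul_gen_self i
        calc _ = gen i * y * 1 * z * star (gen j) := by simp [mul_assoc]
          _ = _ := by rw [← h]; simp only [mul_assoc]
      rw [this]
      exact mul_mem (hy i i) (hz i j)
    | star y _ hy =>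
      intro i j
      have : gen i * star y * star (gen j) = star (gen j * y * star (gen i)) := by
        simp [mul_assoc]
      rw [this]
      exact star_mem (hy j i)
  have hcont : Continuous fun y : CuntzAlgebra n => gen i * y * star (gen j) := by fun_prop
  have hcl : IsClosed (core n : Set (CuntzAlgebra n)) :=
    StarSubalgebra.isClosed_topologicalClosure _
  have : closure _ ⊆ _ := closure_minimal (fun y hy => key y hy i j) (hcl.preimage hcont)
  exact this hx

theorem IsPermutative.isWordSum {α : Aut n} (hα : IsPermutative α) {x : CuntzAlgebra n}
    (hx : IsWordSum x) : IsWordSum (α x) := by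
  obtain ⟨u, hu, hαu⟩ := hα
  have hw : ∀ μ : List (Fin n), IsWordSum (α (word μ)) := by
    intro μ
    induction μ with
    | nil => rw [word_nil, map_one]; exact isWordSum_one
    | cons i μ ih =>
      rw [word_cons, map_mul, hαu]
      exact (IsWordSum.mul hu.1 (isWordSum_gen i)).mul ih
  obtain ⟨L, rfl⟩ := hx
  rw [map_list_sum, List.map_map]
  refine isWordSum_list_sum _ fun x hx => ?_
  obtain ⟨p, -, rfl⟩ := List.mem_map.1 hx
  simp only [Function.comp_apply, map_mul, map_star]
  exact (hw _).mul (hw _).star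

open scoped CStarAlgebra in
theorem IsPermutative.mem_core {α : Aut n} (hα : IsPermutative α) {x : CuntzAlgebra n}
    (hx : x ∈ core n) : α x ∈ core n := by
  obtain ⟨u, hu, hαu⟩ := hα
  have hw : ∀ μ ν : List (Fin n), μ.length = ν.length →
      α (word μ * star (word ν)) ∈ core n := by
    intro μ
    induction μ with
    | nil =>
      intro ν hν
      obtain rfl : ν = [] := List.length_eq_zero_iff.1 hν.symm
      simp only [word_nil, star_one, mul_one, map_one]
      exact one_mem _
    | cons i μ ih =>
      intro ν hν
      cases ν with
      | nil => simp at hν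
      | cons j ν =>
        have : α (word (i :: μ) * star (word (j :: ν)))
            = u * (gen i * α (word μ * star (word ν)) * star (gen j)) * star (u : CuntzAlgebra n) := by
          simp [word_cons, mul_assoc, map_star, hαu]
        rw [this]
        exact mul_mem (mul_mem hu.2
          (gen_mul_mul_star_gen_mem_core (ih ν (by simpa using hν)) i j)) (star_mem hu.2)
  have hle : core n ≤ (core n).comap (α : CuntzAlgebra n →⋆ₐ[ℂ] CuntzAlgebra n) := by
    refine StarSubalgebra.topologicalClosure_minimal (StarAlgebra.adjoin_le ?_) ?_
    · rintro _ ⟨μ, ν, h, rfl⟩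
      exact hw μ ν h
    · exact (StarSubalgebra.isClosed_topologicalClosure _).preimage
        (map_continuous (α : CuntzAlgebra n →⋆ₐ[ℂ] CuntzAlgebra n))
  exact hle hx

/-- The image of a unitary under an automorphism. -/
def Aut.mapUnitary (α : Aut n) (u : unitary (CuntzAlgebra n)) : unitary (CuntzAlgebra n) :=
  ⟨α u, by
    rw [Unitary.mem_iff, ← map_star, ← map_mul, ← map_mul]
    simp⟩

theorem Aut.coe_mapUnitary (α : Aut n) (u : unitary (CuntzAlgebra n)) :
    (α.mapUnitary u : CuntzAlgebra n) = α u := rfl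

theorem IsPermutative.mapUnitary_mem {α : Aut n} (hα : IsPermutative α)
    {u : unitary (CuntzAlgebra n)} (hu : u ∈ permUnitaries n) :
    α.mapUnitary u ∈ permUnitaries n :=
  ⟨show IsWordSum _ from hα.isWordSum hu.1, hα.mem_core hu.2⟩

theorem isPermutative_one : IsPermutative (1 : Aut n) :=
  ⟨1, one_mem _, fun i => by simp⟩

theorem IsPermutative.mul {α β : Aut n} (hα : IsPermutative α) (hβ : IsPermutative β) :
    IsPermutative (α * β) := by
  obtain ⟨u, hu, hαu⟩ := id hα
  obtain ⟨v, hv, hβv⟩ := hβ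
  refine ⟨α.mapUnitary v * u, mul_mem (hα.mapUnitary_mem hv) hu, fun i => ?_⟩
  rw [StarAlgEquiv.mul_apply, hβv, map_mul, hαu, Submonoid.coe_mul, Aut.coe_mapUnitary, mul_assoc]

theorem isPermutative_Ad {u : unitary (CuntzAlgebra n)} (hu : u ∈ permUnitaries n) :
    IsPermutative (Ad u) := by
  have hsum : ∀ v w : CuntzAlgebra n, (∑ i : Fin n, gen i * v * star (gen i)) *
      (∑ i : Fin n, gen i * w * star (gen i)) = ∑ i : Fin n, gen i * (v * w) * star (gen i) := by
    intro v w
    rw [Finset.sum_mul]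
    refine Finset.sum_congr rfl fun i _ => ?_
    rw [Finset.mul_sum, Finset.sum_eq_single i]
    · calc _ = gen i * v * (star (gen i) * gen i) * w * star (gen i) := by simp only [mul_assoc]
        _ = _ := by rw [star_gen_mul_gen_self]; simp only [mul_assoc, one_mul]
    · intro j _ hj
      calc _ = gen i * v * (star (gen i) * gen j) * w * star (gen j) := by simp only [mul_assoc]
        _ = 0 := by rw [star_gen_mul_gen_of_ne hj.symm]; simp
    · simp
  have hstar : star (∑ i : Fin n, gen i * star (u : CuntzAlgebra n) * star (gen i))
      = ∑ i : Fin n, gen i * (u : CuntzAlgebra n) * star (gen i) := by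
    simp [mul_assoc]
  let φu : unitary (CuntzAlgebra n) :=
    ⟨∑ i : Fin n, gen i * star (u : CuntzAlgebra n) * star (gen i), by
      rw [Unitary.mem_iff, hstar, hsum, hsum]
      simp [sum_gen_mul_star_gen]⟩
  have hφu : φu ∈ permUnitaries n :=
    ⟨show IsWordSum (∑ i : Fin n, gen i * star (u : CuntzAlgebra n) * star (gen i)) from
      isWordSum_finset_sum _ _ fun i _ =>
      ((isWordSum_gen i).mul (IsWordSum.star hu.1)).mul (isWordSum_gen i).star,
      show (∑ i : Fin n, gen i * star (u : CuntzAlgebra n) * star (gen i)) ∈ core n from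
        sum_mem fun i _ => gen_mul_mul_star_gen_mem_core (star_mem hu.2) i i⟩
  refine ⟨u * φu, mul_mem hu hφu, fun i => ?_⟩
  have h : (φu : CuntzAlgebra n) * gen i = gen i * star (u : CuntzAlgebra n) := by
    change (∑ j : Fin n, gen j * star (u : CuntzAlgebra n) * star (gen j)) * gen i = _
    rw [Finset.sum_mul, Finset.sum_eq_single i]
    · rw [mul_assoc, star_gen_mul_gen_self, mul_one]
    · intro j _ hj
      rw [mul_assoc, star_gen_mul_gen_of_ne hj, mul_zero]
    · simp
  rw [Submonoid.coe_mul, mul_assoc, h, Unitary.conjStarAlgAut_apply, mul_assoc]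

/-- The restricted Weyl group `λ(𝒫ₙ)⁻¹`: the group of permutative automorphisms of `𝒪ₙ`.
That the inverse of an automorphism `λ_u` with `u ∈ 𝒫ₙ` has again this form is made part of the
definition; this is automatic for permutative automorphisms of `𝒪ₙ`. -/
def restrictedWeyl (n : ℕ) : Subgroup (Aut n) where
  carrier := {α | IsPermutative α ∧ IsPermutative α⁻¹}
  mul_mem' := fun {a b} ha hb => ⟨ha.1.mul hb.1, by rw [mul_inv_rev]; exact hb.2.mul ha.2⟩
  one_mem' := ⟨isPermutative_one, by rw [inv_one]; exact isPermutative_one⟩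
  inv_mem' := fun {a} ha => ⟨ha.2, by rw [inv_inv]; exact ha.1⟩

theorem Ad_mem_restrictedWeyl {u : unitary (CuntzAlgebra n)} (hu : u ∈ permUnitaries n) :
    Ad u ∈ restrictedWeyl n :=
  ⟨isPermutative_Ad hu, by rw [← map_inv]; exact isPermutative_Ad (inv_mem hu)⟩

/-- `Inn λ(𝒫ₙ)⁻¹ = {Ad u : u ∈ 𝒫ₙ}`, as a subgroup of the restricted Weyl group. -/
def innerWeyl (n : ℕ) : Subgroup (restrictedWeyl n) :=
  ((permUnitaries n).map Ad).subgroupOf (restrictedWeyl n)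

instance innerWeyl.instNormal (n : ℕ) : (innerWeyl n).Normal where
  conj_mem := by
    rintro a ⟨u, hu, hua⟩ g
    refine ⟨(g : Aut n).mapUnitary u, g.2.1.mapUnitary_mem hu, ?_⟩
    have hua' : (a : Aut n) = Ad u := hua.symm
    change Ad _ = (g : Aut n) * (a : Aut n) * (g : Aut n)⁻¹
    rw [eq_mul_inv_iff_mul_eq, hua']
    ext x
    simp [StarAlgEquiv.mul_apply, Aut.coe_mapUnitary, map_star]

/-- The restricted outer Weyl group `λ(𝒫ₙ)⁻¹ / Inn λ(𝒫ₙ)⁻¹`. -/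
abbrev RestrictedOuterWeyl (n : ℕ) : Type 1 := restrictedWeyl n ⧸ innerWeyl n

end CuntzAlgebra

/-! ### The full one-sided shift -/

/-- The full one-sided `n`-shift space with the product topology. -/
abbrev ShiftSpace (n : ℕ) : Type := ℕ → Fin n

namespace ShiftSpace

variable {n : ℕ}

/-- The one-sided shift. -/
def shift (x : ShiftSpace n) : ShiftSpace n := fun k => x (k + 1)

/-- `Aut(Xₙ)`: the homeomorphisms of the one-sided shift space that commute with the shift. -/
def autShift (n : ℕ) : Subgroup (ShiftSpace n ≃ₜ ShiftSpace n) where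
  carrier := {f | ∀ x, f (shift x) = shift (f x)}
  mul_mem' := fun {a b} ha hb x => by
    change a (b (shift x)) = shift (a (b x))
    rw [hb, ha]
  one_mem' := fun _ => rfl
  inv_mem' := fun {a} ha x => by
    change a.symm (shift x) = shift (a.symm x)
    apply a.injective
    rw [ha, a.apply_symm_apply, a.apply_symm_apply]

/-- The cylinder set of all sequences that begin with the word `μ`. -/
def cylinder (μ : List (Fin n)) : Set (ShiftSpace n) :=
  {x | ∀ k : Fin μ.length, x k = μ.get k}

theorem isClopen_cylinder (μ : List (Fin n)) : IsClopen (cylinder μ) := by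
  have : cylinder μ = ⋂ k : Fin μ.length, (fun x : ShiftSpace n => x k) ⁻¹' {μ.get k} := by
    ext x; simp [cylinder]
  rw [this]
  exact isClopen_iInter_of_finite fun k =>
    (isClopen_discrete _).preimage (continuous_apply (k : ℕ))

/-- The characteristic function of a cylinder set, as a continuous function. -/
def cylinderFn (μ : List (Fin n)) : C(ShiftSpace n, ℂ) :=
  (LocallyConstant.charFn ℂ (isClopen_cylinder μ) : LocallyConstant (ShiftSpace n) ℂ)

end ShiftSpace

/-- `Φ` is the natural identification of `C(Xₙ)` with `𝒟ₙ`, under which the characteristic function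
of the cylinder set of `μ` corresponds to the projection `P_μ`. -/
def IsNaturalIdentification {n : ℕ}
    (Φ : C(ShiftSpace n, ℂ) ≃⋆ₐ[ℂ] CuntzAlgebra.diagonal n) : Prop :=
  ∀ μ : List (Fin n),
    (Φ (ShiftSpace.cylinderFn μ) : CuntzAlgebra n) = CuntzAlgebra.rangeProj μ

/-- The automorphism `β` of `𝒪ₙ` extends the automorphism `g ↦ g ∘ f⁻¹` of `C(Xₙ) ≅ 𝒟ₙ`
given by the homeomorphism `f` of `Xₙ`. -/
def Extends {n : ℕ} (Φ : C(ShiftSpace n, ℂ) ≃⋆ₐ[ℂ] CuntzAlgebra.diagonal n)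
    (f : ShiftSpace n ≃ₜ ShiftSpace n) (β : CuntzAlgebra.Aut n) : Prop :=
  ∀ g : C(ShiftSpace n, ℂ),
    β (Φ g : CuntzAlgebra n) = (Φ (g.comp (f.symm : C(ShiftSpace n, ShiftSpace n))) : CuntzAlgebra n)

end

/-! Write `ι` for the embedding of `C(Xₙ)` in `𝒪ₙ` with image `𝒟ₙ`. It exists by Gelfand duality: a
character of `𝒟ₙ` is determined by the infinite word whose prefixes `μ` are those with `χ(P_μ) = 1`,
and every infinite word occurs.

Existence. The element `S = ∑ Sⱼ` satisfies `Pᵢ S = Sᵢ` and `S ι(g) = ι(g ∘ σ) S`, where `σ` is the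
shift, and `S* ι(g) S = ι(∑ⱼ g(j·))`. Put `β_f(Sᵢ) = ι(1_[i] ∘ f⁻¹) S`. Because `f⁻¹` commutes with
`σ`, it maps each fibre of `σ` bijectively onto a fibre, and this gives the Cuntz relations. As
`β_f` fixes `S` and acts on `𝒟ₙ` by `f` (`shiftEndo_apply`), `f ↦ β_f` is multiplicative
(`shiftAut`).

Uniqueness. The quotient of two permutative extensions is a permutative `λ_u` that fixes `𝒟ₙ`, so
`u` commutes with `𝒟ₙ`. On `ℓ²(Xₙ)` such a `u` is diagonal. A sum of words has natural number
coefficients, so nothing cancels, and `u S_ν` is a multiple of `S_ν` for every long `ν`; being an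
isometry it equals `S_ν`, so `u = 1` (`eq_one_of_commute`).

Outerness. Suppose `β_f = Ad u`. In the representation on `ℓ²` of the tail class of `x`, the nonzero
vector `u δ_x` is an eigenvector of `𝒟ₙ` with character `f(x)`, so `f(x)` lies in the tail class of
`x`: `σᵏ f(x) = σˡ x` for some `k`, `l`. By Baire's theorem one pair `k`, `l` serves a whole
cylinder, hence all of `Xₙ`, and since no positive power of `σ` is injective, `f = id`
(`eq_one_of_tail`). The same statement shows that the homomorphism to the outer group has trivial
kernel. -/

noncomputable section

open scoped ENNReal

/-! ### Cylinder sets and continuous functions on the shift space. -/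

namespace ShiftSpace

variable {n : ℕ}

/-- The sequence `i x₀ x₁ …`. -/
def cons (i : Fin n) (x : ShiftSpace n) : ShiftSpace n
  | 0 => i
  | k + 1 => x k

@[simp] theorem cons_zero (i : Fin n) (x : ShiftSpace n) : cons i x 0 = i := rfl

@[simp] theorem shift_cons (i : Fin n) (x : ShiftSpace n) : shift (cons i x) = x := rfl

@[simp] theorem cons_shift (x : ShiftSpace n) : cons (x 0) (shift x) = x := by
  funext k; cases k <;> rfl

theorem cons_eq_iff {i : Fin n} {x y : ShiftSpace n} : y = cons i x ↔ y 0 = i ∧ shift y = x := by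
  constructor
  · rintro rfl; simp
  · rintro ⟨rfl, rfl⟩; simp

theorem continuous_cons (i : Fin n) : Continuous (cons i : ShiftSpace n → ShiftSpace n) := by
  refine continuous_pi fun k => ?_
  cases k with
  | zero => exact continuous_const
  | succ k => exact continuous_apply k

theorem continuous_shift : Continuous (shift : ShiftSpace n → ShiftSpace n) :=
  continuous_pi fun k => continuous_apply (k + 1)

/-- `cons i` as a continuous map. -/
def consMap (i : Fin n) : C(ShiftSpace n, ShiftSpace n) := ⟨cons i, continuous_cons i⟩

/-- The shift as a continuous map. -/
def shiftMap (n : ℕ) : C(ShiftSpace n, ShiftSpace n) := ⟨shift, continuous_shift⟩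

/-- The prefix of length `k`. -/
def pre (x : ShiftSpace n) : ℕ → List (Fin n)
  | 0 => []
  | k + 1 => x 0 :: pre (shift x) k

@[simp] theorem length_pre (x : ShiftSpace n) (k : ℕ) : (pre x k).length = k := by
  induction k generalizing x with
  | zero => rfl
  | succ k ih => simp [pre, ih]

theorem pre_succ (x : ShiftSpace n) (k : ℕ) : pre x (k + 1) = pre x k ++ [x k] := by
  induction k generalizing x with
  | zero => rfl
  | succ k ih =>
    rw [pre, ih]
    rfl

theorem mem_cylinder_nil (x : ShiftSpace n) : x ∈ cylinder ([] : List (Fin n)) :=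
  fun k => k.elim0

theorem mem_cylinder_cons {x : ShiftSpace n} {i : Fin n} {μ : List (Fin n)} :
    x ∈ cylinder (i :: μ) ↔ x 0 = i ∧ shift x ∈ cylinder μ := by
  constructor
  · intro h
    exact ⟨h ⟨0, by simp⟩, fun k => h k.succ⟩
  · rintro ⟨h0, h⟩ k
    refine Fin.cases ?_ (fun k => ?_) k
    · exact h0
    · exact h k

theorem mem_cylinder_iff {x : ShiftSpace n} {μ : List (Fin n)} :
    x ∈ cylinder μ ↔ pre x μ.length = μ := by
  induction μ generalizing x with
  | nil => simp [mem_cylinder_nil, pre]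
  | cons i μ ih => simp [mem_cylinder_cons, pre, ih]

theorem mem_cylinder_append {x : ShiftSpace n} {i : Fin n} {μ : List (Fin n)} :
    x ∈ cylinder (μ ++ [i]) ↔ x ∈ cylinder μ ∧ x μ.length = i := by
  simp [mem_cylinder_iff, pre_succ]

/-- Prepend a finite word to a sequence. -/
def append (μ : List (Fin n)) (x : ShiftSpace n) : ShiftSpace n := μ.foldr cons x

@[simp] theorem append_nil (x : ShiftSpace n) : append [] x = x := rfl

@[simp] theorem append_cons (i : Fin n) (μ : List (Fin n)) (x : ShiftSpace n) :
    append (i :: μ) x = cons i (append μ x) := rfl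

@[simp] theorem shift_iterate_append (μ : List (Fin n)) (x : ShiftSpace n) :
    shift^[μ.length] (append μ x) = x := by
  induction μ with
  | nil => rfl
  | cons i μ ih => simpa using ih

theorem append_mem_cylinder (μ : List (Fin n)) (x : ShiftSpace n) : append μ x ∈ cylinder μ := by
  induction μ with
  | nil => exact mem_cylinder_nil _
  | cons i μ ih => exact mem_cylinder_cons.2 ⟨rfl, ih⟩

theorem cylinderFn_apply (μ : List (Fin n)) (x : ShiftSpace n) [Decidable (x ∈ cylinder μ)] :
    cylinderFn μ x = if x ∈ cylinder μ then 1 else 0 := by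
  classical
  change (LocallyConstant.charFn ℂ (isClopen_cylinder μ)) x = _
  rw [LocallyConstant.coe_charFn, Set.indicator_apply]
  congr

theorem apply_eq_of_pre_eq {x z : ShiftSpace n} {k : ℕ} (h : pre z k = pre x k) {i : ℕ}
    (hi : i < k) : z i = x i := by
  induction k generalizing x z i with
  | zero => omega
  | succ k ih =>
    simp only [pre, List.cons.injEq] at h
    cases i with
    | zero => exact h.1
    | succ i => exact ih (x := shift x) (z := shift z) h.2 (by omega)

theorem exists_cylinder_subset {x : ShiftSpace n} {U : Set (ShiftSpace n)} (hU : IsOpen U)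
    (hx : x ∈ U) : ∃ k, cylinder (pre x k) ⊆ U := by
  obtain ⟨_, ⟨y, k, rfl⟩, hxy, hk⟩ :=
    (PiNat.isTopologicalBasis_cylinders (fun _ : ℕ => Fin n)).exists_subset_of_mem_open hx hU
  refine ⟨k, fun z hz => hk fun i hi => ?_⟩
  rw [← hxy i hi]
  exact apply_eq_of_pre_eq (by simpa [mem_cylinder_iff] using hz) hi

/-- König's lemma for the tree of words. -/
theorem exists_forall_pre {Q : List (Fin n) → Prop} (h0 : Q [])
    (hs : ∀ μ, Q μ → ∃ i, Q (μ ++ [i])) : ∃ x : ShiftSpace n, ∀ k, Q (pre x k) := by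
  choose next hnext using hs
  let s : ℕ → {μ // Q μ} := fun k => Nat.rec ⟨[], h0⟩ (fun _ p => ⟨_, hnext p.1 p.2⟩) k
  let x : ShiftSpace n := fun k => next (s k).1 (s k).2
  have hx : ∀ k, pre x k = (s k).1 := by
    intro k
    induction k with
    | zero => rfl
    | succ k ih => rw [pre_succ, ih]
  exact ⟨x, fun k => by rw [hx]; exact (s k).2⟩

/-- The span of the characteristic functions of cylinder sets is dense. -/
theorem closure_span_cylinderFn :
    (Submodule.span ℂ (Set.range (cylinderFn : List (Fin n) → C(ShiftSpace n, ℂ)))).topologicalClosure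
      = ⊤ := by
  classical
  rw [eq_top_iff]
  rintro g -
  change g ∈ closure _
  rw [Metric.mem_closure_iff]
  intro ε hε
  -- The approximation is localized to a cylinder. Vanishing outside it lets solutions on the `n`
  -- subcylinders be added to one on the parent cylinder.
  suffices H : ∃ h ∈ Submodule.span ℂ (Set.range (cylinderFn : List (Fin n) → C(ShiftSpace n, ℂ))),
      (∀ x ∈ cylinder ([] : List (Fin n)), dist (g x) (h x) < ε) ∧
      ∀ x ∉ cylinder ([] : List (Fin n)), h x = 0 by
    obtain ⟨h, hh, h1, -⟩ := H
    exact ⟨h, hh, (ContinuousMap.dist_lt_iff hε).2 fun x => h1 x (mem_cylinder_nil x)⟩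
  by_contra hcon
  -- If no approximant exists on a cylinder, none exists on some subcylinder. The resulting branch
  -- `x` has no approximant on any of its cylinders, while continuity of `g` at `x` makes a constant
  -- work on a small one.
  obtain ⟨x, hx⟩ := exists_forall_pre (Q := fun μ => ¬ ∃ h ∈ Submodule.span ℂ
      (Set.range (cylinderFn : List (Fin n) → C(ShiftSpace n, ℂ))),
      (∀ x ∈ cylinder μ, dist (g x) (h x) < ε) ∧ ∀ x ∉ cylinder μ, h x = 0) hcon (by
    intro μ hμ
    by_contra! hi
    choose h hh h1 h2 using hi
    refine hμ ⟨∑ i, h i, Submodule.sum_mem _ fun i _ => hh i, fun x hx => ?_, fun x hx => ?_⟩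
    · rw [ContinuousMap.sum_apply, Finset.sum_eq_single (x μ.length)]
      · exact h1 _ x (mem_cylinder_append.2 ⟨hx, rfl⟩)
      · intro j _ hj
        exact h2 j x fun hx' => hj (mem_cylinder_append.1 hx').2.symm
      · simp
    · rw [ContinuousMap.sum_apply]
      exact Finset.sum_eq_zero fun i _ => h2 i x fun hx' => hx (mem_cylinder_append.1 hx').1)
  obtain ⟨k, hk⟩ := exists_cylinder_subset
    (Metric.isOpen_ball.preimage g.continuous : IsOpen (g ⁻¹' Metric.ball (g x) ε))
    (Metric.mem_ball_self hε)
  refine hx k ⟨g x • cylinderFn (pre x k), Submodule.smul_mem _ _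
    (Submodule.subset_span ⟨_, rfl⟩), fun y hy => ?_, fun y hy => ?_⟩
  · simpa [cylinderFn_apply, hy] using hk hy
  · simp [cylinderFn_apply, hy]

/-- To show that two continuous linear operations on `C(Xₙ)` agree, it is enough to look at
characteristic functions of cylinder sets. -/
theorem eq_of_eq_cylinderFn {E : Type*} [AddCommGroup E] [Module ℂ E] [TopologicalSpace E]
    [T2Space E] (A B : C(ShiftSpace n, ℂ) →ₗ[ℂ] E) (hA : Continuous A) (hB : Continuous B)
    (h : ∀ μ, A (cylinderFn μ) = B (cylinderFn μ)) : A = B := by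
  have h1 : Submodule.span ℂ (Set.range (cylinderFn : List (Fin n) → C(ShiftSpace n, ℂ)))
      ≤ LinearMap.eqLocus A B := by
    rw [Submodule.span_le]
    rintro _ ⟨μ, rfl⟩
    exact h μ
  ext1 g
  have hg : g ∈ (Submodule.span ℂ
      (Set.range (cylinderFn : List (Fin n) → C(ShiftSpace n, ℂ)))).topologicalClosure := by
    rw [closure_span_cylinderFn]; trivial
  exact closure_minimal h1 (isClosed_eq hA hB) hg

/-- The indicator function of a clopen set is a finite sum of indicator functions of
cylinder sets. -/
theorem exists_list_sum_cylinderFn {A : Set (ShiftSpace n)} (hA : IsClopen A) :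
    ∃ L : List (List (Fin n)), ∀ x, ((L.map cylinderFn).sum : C(ShiftSpace n, ℂ)) x
      = A.indicator 1 x := by
  classical
  suffices H : ∃ L : List (List (Fin n)), ∀ x, ((L.map cylinderFn).sum : C(ShiftSpace n, ℂ)) x
      = (A ∩ cylinder []).indicator 1 x by
    obtain ⟨L, hL⟩ := H
    refine ⟨L, fun x => (hL x).trans ?_⟩
    simp [Set.indicator_apply, mem_cylinder_nil]
  by_contra hcon
  -- Again a bad branch: lists for the subcylinders concatenate to one for the parent, but a small
  -- cylinder around `x` lies inside `A` or inside its complement.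
  obtain ⟨x, hx⟩ := exists_forall_pre (Q := fun μ => ¬ ∃ L : List (List (Fin n)),
      ∀ x, ((L.map cylinderFn).sum : C(ShiftSpace n, ℂ)) x
        = (A ∩ cylinder μ).indicator 1 x) hcon (by
    intro μ hμ
    by_contra! hi
    choose L hL using hi
    refine hμ ⟨(List.finRange n).flatMap L, fun x => ?_⟩
    have : (((List.finRange n).flatMap L).map cylinderFn).sum
        = ∑ i, ((L i).map (cylinderFn : _ → C(ShiftSpace n, ℂ))).sum := by
      rw [List.map_flatMap, List.flatMap_def, List.sum_flatten, List.map_map, ← List.ofFn_eq_map,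
        List.sum_ofFn]
      rfl
    rw [this, ContinuousMap.sum_apply]
    simp only [hL, Set.indicator_apply, Set.mem_inter_iff, mem_cylinder_append]
    by_cases hxA : x ∈ A <;> by_cases hxμ : x ∈ cylinder μ <;> simp [hxA, hxμ])
  by_cases hxA : x ∈ A
  · obtain ⟨k, hk⟩ := exists_cylinder_subset hA.isOpen hxA
    refine hx k ⟨[pre x k], fun y => ?_⟩
    rw [Set.inter_eq_right.2 hk]
    simp [cylinderFn_apply, Set.indicator_apply]
  · obtain ⟨k, hk⟩ := exists_cylinder_subset hA.compl.isOpen hxA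
    refine hx k ⟨[], fun y => ?_⟩
    rw [Set.disjoint_iff_inter_eq_empty.1 (Set.subset_compl_iff_disjoint_left.1 hk)]
    simp

end ShiftSpace

/-! ### Basis vectors and isometries of `ℓ²` spaces. -/

/-- The Hilbert space `ℓ²(I)`. -/
abbrev EllTwo (I : Type) : Type := lp (fun _ : I => ℂ) 2

namespace EllTwo

variable {I J : Type}

open scoped Classical in
/-- The standard basis vectors. -/
def basisVec (y : I) : EllTwo I := lp.single 2 y (1 : ℂ)

open scoped Classical in
theorem basisVec_apply (y z : I) : basisVec y z = if z = y then 1 else 0 := by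
  rw [basisVec, lp.single_apply, Pi.single_apply]

theorem inner_basisVec (y : I) (ξ : EllTwo I) : inner ℂ (basisVec y) ξ = ξ y := by
  classical
  rw [basisVec, lp.inner_single_left]
  simp

theorem orthonormal_basisVec : Orthonormal ℂ (basisVec : I → EllTwo I) := by
  classical
  rw [orthonormal_iff_ite]
  intro y z
  rw [inner_basisVec, basisVec_apply]

theorem norm_basisVec (y : I) : ‖basisVec y‖ = 1 := orthonormal_basisVec.1 y

theorem ext_basisVec {A B : EllTwo I →L[ℂ] EllTwo I}
    (h : ∀ y, A (basisVec y) = B (basisVec y)) : A = B := by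
  classical
  refine lp.ext_continuousLinearMap (by simp) fun y => ?_
  ext1
  simpa [basisVec] using h y

/-- The isometry of `ℓ²` spaces given by an injective map. -/
def mapIsometry (g : I ↪ J) : EllTwo I →ₗᵢ[ℂ] EllTwo J :=
  (orthonormal_basisVec.comp g g.injective).orthogonalFamily.linearIsometry

theorem mapIsometry_basisVec (g : I ↪ J) (y : I) :
    mapIsometry g (basisVec y) = basisVec (g y) := by
  classical
  rw [mapIsometry, basisVec, OrthogonalFamily.linearIsometry_apply_single]
  simp

end EllTwo

/-! ### Permutation representations of the Cuntz algebra. -/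

namespace CuntzAlgebra

variable {n : ℕ} {I : Type}

open EllTwo

/-- The isometry `δ_y ↦ δ_{e(i, y)}`. -/
def repGen (e : Fin n × I ≃ I) (i : Fin n) : EllTwo I →L[ℂ] EllTwo I :=
  (mapIsometry ⟨fun y => e (i, y), fun y z h => by simpa using h⟩).toContinuousLinearMap

theorem repGen_basisVec (e : Fin n × I ≃ I) (i : Fin n) (y : I) :
    repGen e i (basisVec y) = basisVec (e (i, y)) :=
  mapIsometry_basisVec _ y

theorem star_repGen_basisVec (e : Fin n × I ≃ I) (i j : Fin n) (y : I) :
    star (repGen e i) (basisVec (e (j, y))) = if i = j then basisVec y else 0 := by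
  ext z
  rw [← inner_basisVec, ContinuousLinearMap.star_eq_adjoint,
    ContinuousLinearMap.adjoint_inner_right, repGen_basisVec, inner_basisVec, basisVec_apply]
  by_cases hij : i = j
  · subst hij
    by_cases hz : z = y <;> simp [hz, basisVec_apply]
  · simp [hij]

theorem star_repGen_mul_self (e : Fin n × I ≃ I) (i : Fin n) :
    star (repGen e i) * repGen e i = 1 := by
  refine ext_basisVec fun y => ?_
  simp [repGen_basisVec, star_repGen_basisVec]

theorem sum_repGen_mul_star (e : Fin n × I ≃ I) :
    ∑ i, repGen e i * star (repGen e i) = 1 := by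
  refine ext_basisVec fun y => ?_
  obtain ⟨⟨j, y⟩, rfl⟩ := e.surjective y
  rw [sum_apply, Finset.sum_eq_single j]
  · simp [repGen_basisVec, star_repGen_basisVec]
  · intro i _ hi
    simp [star_repGen_basisVec, hi]
  · simp

instance [Nonempty I] : Nontrivial (EllTwo I →L[ℂ] EllTwo I) := by
  obtain ⟨y⟩ := ‹Nonempty I›
  have : Nontrivial (EllTwo I) := ⟨basisVec y, 0, fun h => by
    simpa [h] using norm_basisVec y⟩
  infer_instance

variable [Nonempty I]

/-- The representation of `𝒪ₙ` on `ℓ²(I)` by `Sᵢ δ_y = δ_{e(i, y)}`. -/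
def rep (e : Fin n × I ≃ I) : CuntzAlgebra n →⋆ₐ[ℂ] (EllTwo I →L[ℂ] EllTwo I) :=
  (existsUnique_hom _ (repGen e) (star_repGen_mul_self e) (sum_repGen_mul_star e)).choose

theorem rep_gen (e : Fin n × I ≃ I) (i : Fin n) : rep e (gen i) = repGen e i :=
  (existsUnique_hom _ (repGen e) (star_repGen_mul_self e) (sum_repGen_mul_star e)).choose_spec.1 i

/-- The map `c` labels basis vectors by sequences so that `e` becomes concatenation; every `P_μ` is
then diagonal. It is applied to the whole shift space and to single tail classes. -/
theorem rep_rangeProj (e : Fin n × I ≃ I) {c : I → ShiftSpace n}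
    (hc : ∀ i y, c (e (i, y)) = ShiftSpace.cons i (c y)) (μ : List (Fin n)) (y : I) :
    rep e (rangeProj μ) (basisVec y) = ShiftSpace.cylinderFn μ (c y) • basisVec y := by
  classical
  induction μ generalizing y with
  | nil => simp [rangeProj, word_nil, ShiftSpace.cylinderFn_apply, ShiftSpace.mem_cylinder_nil]
  | cons i μ ih =>
    obtain ⟨⟨j, y⟩, rfl⟩ := e.surjective y
    have : rangeProj (i :: μ) = gen i * rangeProj μ * star (gen i) := by
      simp [rangeProj, word_cons, mul_assoc]
    rw [this, map_mul, map_mul, map_star, rep_gen, mul_apply_eq_comp,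
      mul_apply_eq_comp, star_repGen_basisVec, hc]
    by_cases hij : i = j
    · subst hij
      rw [if_pos rfl, ih, map_smul, repGen_basisVec]
      congr 1
      simp [ShiftSpace.cylinderFn_apply, ShiftSpace.mem_cylinder_cons]
    · have hji : ¬ j = i := fun h => hij h.symm
      simp [hij, hji, ShiftSpace.cylinderFn_apply, ShiftSpace.mem_cylinder_cons]

/-- The bijection `(i, x) ↦ ix`. -/
def consEquiv (n : ℕ) : Fin n × ShiftSpace n ≃ ShiftSpace n where
  toFun p := ShiftSpace.cons p.1 p.2
  invFun x := (x 0, ShiftSpace.shift x)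
  left_inv p := by simp
  right_inv x := by simp

/-- A unital homomorphism to a nonzero algebra has nonzero domain. For `n = 0` the empty sum of
range projections would force `1 = 0`. -/
theorem nontrivial_of_ne_zero (hn : n ≠ 0) : Nontrivial (CuntzAlgebra n) := by
  have : NeZero n := ⟨hn⟩
  exact (rep (consEquiv n)).toRingHom.domain_nontrivial

end CuntzAlgebra

/-! ### The spectrum of the diagonal. -/

namespace CuntzAlgebra

variable {n : ℕ}

theorem rangeProj_nil : rangeProj ([] : List (Fin n)) = 1 := by simp [rangeProj, word_nil]

theorem rangeProj_cons (i : Fin n) (μ : List (Fin n)) :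
    rangeProj (i :: μ) = gen i * rangeProj μ * star (gen i) := by
  simp [rangeProj, word_cons, mul_assoc]

theorem star_rangeProj (μ : List (Fin n)) : star (rangeProj μ) = rangeProj μ := by
  simp [rangeProj]

theorem star_word_mul_self (μ : List (Fin n)) : star (word μ) * word μ = 1 := by
  induction μ with
  | nil => simp [word_nil]
  | cons i μ ih =>
    rw [word_cons, star_mul, mul_assoc, ← mul_assoc (star (gen i)), star_gen_mul_gen_self, one_mul,
      ih]

theorem gen_mul_star_mul_gen (i j : Fin n) (x y : CuntzAlgebra n) :
    gen i * x * star (gen i) * (gen j * y * star (gen j))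
      = if i = j then gen i * (x * y) * star (gen i) else 0 := by
  have h : gen i * x * star (gen i) * (gen j * y * star (gen j))
      = gen i * x * (star (gen i) * gen j) * y * star (gen j) := by simp only [mul_assoc]
  rw [h]
  split_ifs with hij
  · subst hij
    simp [star_gen_mul_gen_self, mul_assoc]
  · simp [star_gen_mul_gen_of_ne hij]

theorem rangeProj_comm (μ ν : List (Fin n)) :
    rangeProj μ * rangeProj ν = rangeProj ν * rangeProj μ := by
  induction μ generalizing ν with
  | nil => simp [rangeProj_nil]
  | cons i μ ih =>
    cases ν with
    | nil => simp [rangeProj_nil]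
    | cons j ν =>
      rw [rangeProj_cons, rangeProj_cons, gen_mul_star_mul_gen, gen_mul_star_mul_gen, ih]
      by_cases h : i = j
      · simp [h]
      · simp [h, Ne.symm h]

theorem rangeProj_mul_self (μ : List (Fin n)) :
    rangeProj μ * rangeProj μ = rangeProj μ := by
  induction μ with
  | nil => simp [rangeProj_nil]
  | cons i μ ih => rw [rangeProj_cons, gen_mul_star_mul_gen, if_pos rfl, ih]

theorem rangeProj_mul_of_ne {μ ν : List (Fin n)} (hl : μ.length = ν.length) (h : μ ≠ ν) :
    rangeProj μ * rangeProj ν = 0 := by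
  induction μ generalizing ν with
  | nil => exact absurd (List.length_eq_zero_iff.1 hl.symm).symm h
  | cons i μ ih =>
    cases ν with
    | nil => simp at hl
    | cons j ν =>
      rw [rangeProj_cons, rangeProj_cons, gen_mul_star_mul_gen]
      split_ifs with hij
      · subst hij
        rw [ih (by simpa using hl) (by simpa using h)]
        simp
      · rfl

theorem sum_rangeProj_append (μ : List (Fin n)) :
    ∑ i, rangeProj (μ ++ [i]) = rangeProj μ := by
  have h : ∀ i, rangeProj (μ ++ [i]) = word μ * (gen i * star (gen i)) * star (word μ) := by
    intro i
    simp [rangeProj, word_append, word_cons, word_nil, mul_assoc]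
  simp_rw [h]
  rw [← Finset.sum_mul, ← Finset.mul_sum, sum_gen_mul_star_gen, mul_one, rangeProj]

theorem rangeProj_ne_zero [Nontrivial (CuntzAlgebra n)] (μ : List (Fin n)) :
    rangeProj μ ≠ 0 := by
  intro h
  have : star (word μ) * rangeProj μ * word μ = 1 := by
    rw [rangeProj]
    calc _ = (star (word μ) * word μ) * (star (word μ) * word μ) := by simp only [mul_assoc]
      _ = 1 := by rw [star_word_mul_self, one_mul]
  rw [h] at this
  simp at this

theorem isClosed_diagonal : IsClosed (diagonal n : Set (CuntzAlgebra n)) :=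
  StarSubalgebra.isClosed_topologicalClosure _

theorem diagonal_mul_comm (x y : diagonal n) : x * y = y * x := by
  have h := StarAlgebra.isMulCommutative_adjoin ℂ
    (s := Set.range (rangeProj : List (Fin n) → CuntzAlgebra n))
    (by rintro _ ⟨μ, rfl⟩ _ ⟨ν, rfl⟩; exact rangeProj_comm μ ν)
    (by rintro _ ⟨μ, rfl⟩ _ ⟨ν, rfl⟩; rw [star_rangeProj]; exact rangeProj_comm μ ν)
  exact (StarSubalgebra.commRingTopologicalClosure _ fun a b => h.is_comm.comm a b).mul_comm x y

/-- The diagonal as a commutative C⋆-algebra. -/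
abbrev diagonalCommCStarAlgebra (n : ℕ) : CommCStarAlgebra (diagonal n) :=
  have : IsClosed (diagonal n : Set (CuntzAlgebra n)) := isClosed_diagonal
  { (inferInstance : CStarAlgebra (diagonal n)) with mul_comm := diagonal_mul_comm }

section Spectrum

attribute [local instance] diagonalCommCStarAlgebra

/-- The projection `P_μ` as an element of the diagonal. -/
def diagProj (μ : List (Fin n)) : diagonal n :=
  ⟨rangeProj μ, StarSubalgebra.le_topologicalClosure _ (StarAlgebra.subset_adjoin ℂ _ ⟨μ, rfl⟩)⟩

-- Since `P_μ = ∑ᵢ P_{μi}`, a word on which `χ` is nonzero has a one-letter extension with the same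
-- property, which yields an infinite branch `x`. Idempotence gives the value `1` on its prefixes,
-- and orthogonality of words of equal length gives `0` elsewhere.
open WeakDual in
theorem exists_point (χ : characterSpace ℂ (diagonal n)) :
    ∃ x : ShiftSpace n, ∀ μ, χ (diagProj μ) = ShiftSpace.cylinderFn μ x := by
  classical
  have hone : χ (diagProj []) = 1 := by
    have : (diagProj [] : diagonal n) = 1 := Subtype.ext rangeProj_nil
    rw [this, map_one]
  obtain ⟨x, hx⟩ := ShiftSpace.exists_forall_pre (Q := fun μ => χ (diagProj μ) ≠ 0)
    (by rw [hone]; exact one_ne_zero) (by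
      intro μ hμ
      by_contra! h
      apply hμ
      have : diagProj μ = ∑ i, diagProj (μ ++ [i]) := by
        apply Subtype.ext
        rw [AddSubmonoidClass.coe_finsetSum]
        exact (sum_rangeProj_append μ).symm
      rw [this, map_sum]
      exact Finset.sum_eq_zero fun i _ => h i)
  refine ⟨x, fun μ => ?_⟩
  rw [ShiftSpace.cylinderFn_apply]
  split_ifs with h
  · rw [ShiftSpace.mem_cylinder_iff] at h
    have h0 := hx μ.length
    rw [h] at h0
    have hid : diagProj μ * diagProj μ = diagProj μ := Subtype.ext (rangeProj_mul_self μ)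
    have h1 := congrArg χ hid
    rw [map_mul] at h1
    exact mul_left_cancel₀ h0 (by rw [h1, mul_one])
  · rw [ShiftSpace.mem_cylinder_iff] at h
    have hid : diagProj (ShiftSpace.pre x μ.length) * diagProj μ = 0 :=
      Subtype.ext (rangeProj_mul_of_ne (by simp) h)
    have h1 := congrArg χ hid
    rw [map_mul, map_zero] at h1
    exact (mul_eq_zero.1 h1).resolve_left (hx _)

open WeakDual in
/-- The sequence `x` with `χ(P_μ) = 1` exactly for the prefixes `μ` of `x`. -/
def point (χ : characterSpace ℂ (diagonal n)) : ShiftSpace n := (exists_point χ).choose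

open WeakDual in
theorem apply_diagProj (χ : characterSpace ℂ (diagonal n)) (μ : List (Fin n)) :
    χ (diagProj μ) = ShiftSpace.cylinderFn μ (point χ) := (exists_point χ).choose_spec μ

open WeakDual in
theorem continuous_point : Continuous (point (n := n)) := by
  classical
  rw [continuous_iff_continuousAt]
  intro χ
  rw [ContinuousAt, tendsto_nhds]
  intro U hU hx
  obtain ⟨k, hk⟩ := ShiftSpace.exists_cylinder_subset hU hx
  have hcont : Continuous fun ψ : characterSpace ℂ (diagonal n) =>
      ψ (diagProj (ShiftSpace.pre (point χ) k)) :=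
    (gelfandTransform ℂ (diagonal n) (diagProj (ShiftSpace.pre (point χ) k))).continuous
  have hopen := isOpen_ne.preimage hcont (t := {z : ℂ | z ≠ 0})
  filter_upwards [hopen.mem_nhds (x := χ) (by
    simp [apply_diagProj, ShiftSpace.cylinderFn_apply, ShiftSpace.mem_cylinder_iff])] with ψ hψ
  apply hk
  by_contra hn
  exact hψ (by simp [apply_diagProj, ShiftSpace.cylinderFn_apply, hn])

open WeakDual in
theorem point_injective : Function.Injective (point (n := n)) := by
  intro χ ψ h
  let E : StarSubalgebra ℂ (diagonal n) := StarAlgHom.equalizer χ ψ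
  have hE : IsClosed (E : Set (diagonal n)) := isClosed_eq (map_continuous χ) (map_continuous ψ)
  -- The diagonal is a closure taken in `𝒪ₙ`, so the equalizer is pushed forward there, where it
  -- stays closed because `𝒟ₙ` is closed.
  have hmap : diagonal n ≤ E.map (diagonal n).subtype := by
    refine StarSubalgebra.topologicalClosure_minimal (StarAlgebra.adjoin_le ?_) ?_
    · rintro _ ⟨μ, rfl⟩
      refine ⟨diagProj μ, ?_, rfl⟩
      change χ (diagProj μ) = ψ (diagProj μ)
      rw [apply_diagProj, apply_diagProj, h]
    · rw [StarSubalgebra.coe_map]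
      exact isClosed_diagonal.isClosedEmbedding_subtypeVal.isClosedMap _ hE
  refine Subtype.ext (ContinuousLinearMap.ext fun a => ?_)
  obtain ⟨b, hb, hba⟩ := hmap a.2
  obtain rfl : b = a := Subtype.ext hba
  exact hb

-- The spectrum is compact, so the range is closed. It is dense because `P_μ ≠ 0`, so some character
-- is nonzero on `P_μ` and its point lies in the cylinder of `μ`.
open WeakDual in
theorem point_surjective [Nontrivial (CuntzAlgebra n)] : Function.Surjective (point (n := n)) := by
  classical
  have hd : DenseRange (point (n := n)) := by
    intro x
    rw [mem_closure_iff]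
    intro U hU hx
    obtain ⟨k, hk⟩ := ShiftSpace.exists_cylinder_subset hU hx
    have hne : gelfandStarTransform (diagonal n) (diagProj (ShiftSpace.pre x k)) ≠ 0 := by
      intro h
      rw [← map_zero (gelfandStarTransform (diagonal n))] at h
      exact rangeProj_ne_zero _
        (congrArg Subtype.val ((gelfandStarTransform (diagonal n)).injective h))
    obtain ⟨χ, hχ⟩ := DFunLike.ne_iff.1 hne
    refine ⟨point χ, hk ?_, χ, rfl⟩
    by_contra hn
    apply hχ
    change χ (diagProj _) = 0
    simp [apply_diagProj, ShiftSpace.cylinderFn_apply, hn]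
  exact Set.range_eq_univ.1 (by
    rw [← (isCompact_range continuous_point).isClosed.closure_eq]; exact hd.closure_range)

open WeakDual in
/-- The homeomorphism of the spectrum of the diagonal with `Xₙ`. -/
def pointHomeo [Nontrivial (CuntzAlgebra n)] :
    characterSpace ℂ (diagonal n) ≃ₜ ShiftSpace n :=
  Continuous.homeoOfEquivCompactToT2
    (f := Equiv.ofBijective point ⟨point_injective, point_surjective⟩) continuous_point

theorem exists_isNaturalIdentification [Nontrivial (CuntzAlgebra n)] :
    ∃ Φ : C(ShiftSpace n, ℂ) ≃⋆ₐ[ℂ] CuntzAlgebra.diagonal n, IsNaturalIdentification Φ := by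
  refine ⟨(pointHomeo.compStarAlgEquiv' ℂ ℂ).trans (gelfandStarTransform (diagonal n)).symm,
    fun μ => ?_⟩
  suffices h : ((pointHomeo.compStarAlgEquiv' ℂ ℂ).trans (gelfandStarTransform (diagonal n)).symm)
      (ShiftSpace.cylinderFn μ) = diagProj μ from congrArg Subtype.val h
  rw [StarAlgEquiv.trans_apply]
  apply (gelfandStarTransform (diagonal n)).injective
  erw [StarAlgEquiv.apply_symm_apply]
  ext χ
  exact (apply_diagProj χ μ).symm

end Spectrum

end CuntzAlgebra

/-! ### Construction of the automorphism of the Cuntz algebra attached to a shift automorphism. -/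

namespace CuntzAlgebra

variable {n : ℕ}

section Endo

variable (T : Fin n → CuntzAlgebra n) (hT : ∀ i, star (T i) * T i = 1)
  (hsum : ∑ i, T i * star (T i) = 1)

/-- The Cuntz family obtained by evaluating a Cuntz family of `𝒪ₙ` in the algebra of `ρ`. -/
abbrev twist (ρ : CuntzFamily n) : CuntzFamily n where
  carrier := ρ.carrier
  -- `existsUnique_hom` takes targets in `Type` only, whereas `𝒪ₙ` lies in `Type 1`. The
  -- endomorphism is therefore obtained coordinatewise: its value at `ρ` is the old value at this
  -- twisted family.
  gen i := incl n (T i) ρ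
  star_mul_self i := by
    have h := congrArg (fun x => incl n x ρ) (hT i)
    rwa [map_mul, map_star, map_one] at h
  sum_range := by
    have h := congrArg (fun x => incl n x ρ) hsum
    simp only [map_sum, map_mul, map_star, map_one] at h
    rw [lp.coeFn_sum, Finset.sum_apply] at h
    exact h

/-- Reindexing of bounded families along `twist`. -/
def ambientMap : CuntzAmbient n →⋆ₐ[ℂ] CuntzAmbient n where
  toFun x := ⟨fun ρ => x (twist T hT hsum ρ), by
    refine memℓp_infty ⟨‖x‖, ?_⟩
    rintro _ ⟨ρ, rfl⟩
    exact lp.norm_apply_le_norm ENNReal.top_ne_zero x (twist T hT hsum ρ)⟩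
  map_one' := rfl
  map_mul' _ _ := rfl
  map_zero' := rfl
  map_add' _ _ := rfl
  commutes' _ := rfl
  map_star' _ := rfl

open scoped CStarAlgebra in
theorem ambientMap_mem (x : CuntzAlgebra n) :
    ambientMap T hT hsum (incl n x) ∈ cuntzSubalgebra n := by
  have hle : cuntzSubalgebra n ≤ (cuntzSubalgebra n).comap (ambientMap T hT hsum) := by
    refine StarSubalgebra.topologicalClosure_minimal (StarAlgebra.adjoin_le ?_) ?_
    · rintro _ ⟨i, rfl⟩
      exact Subtype.property (T i)
    · exact (cuntzSubalgebra.isClosed n).preimage (map_continuous (ambientMap T hT hsum))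
  exact hle (Subtype.property x)

/-- The endomorphism of `𝒪ₙ` that takes `Sᵢ` to `Tᵢ`. -/
def endo : CuntzAlgebra n →⋆ₐ[ℂ] CuntzAlgebra n :=
  StarAlgHom.codRestrict ((ambientMap T hT hsum).comp (incl n)) (cuntzSubalgebra n)
    (ambientMap_mem T hT hsum)

theorem endo_gen (i : Fin n) : endo T hT hsum (gen i) = T i := rfl

end Endo

open scoped CStarAlgebra in
theorem hom_ext {φ ψ : CuntzAlgebra n →⋆ₐ[ℂ] CuntzAlgebra n} (h : ∀ i, φ (gen i) = ψ (gen i)) :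
    φ = ψ := by
  have hc : (⊤ : StarSubalgebra ℂ (CuntzAlgebra n)) ≤ StarAlgHom.equalizer φ ψ := by
    rw [← adjoin_gen]
    refine StarSubalgebra.topologicalClosure_minimal (StarAlgebra.adjoin_le ?_) ?_
    · rintro _ ⟨i, rfl⟩
      exact h i
    · exact isClosed_eq (map_continuous φ) (map_continuous ψ)
  ext x
  exact hc (x := x) trivial

theorem aut_ext {α β : Aut n} (h : ∀ i, α (gen i) = β (gen i)) : α = β := by
  have := hom_ext (φ := (α : CuntzAlgebra n →⋆ₐ[ℂ] CuntzAlgebra n))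
    (ψ := (β : CuntzAlgebra n →⋆ₐ[ℂ] CuntzAlgebra n)) h
  ext x
  exact DFunLike.congr_fun this x

/-- `∑ Sᵢ`. -/
def genSum (n : ℕ) : CuntzAlgebra n := ∑ i, gen i

/-- The function `1_{[i]} ∘ f⁻¹`. -/
def letterFn (f : ShiftSpace n ≃ₜ ShiftSpace n) (i : Fin n) : C(ShiftSpace n, ℂ) :=
  (ShiftSpace.cylinderFn [i]).comp (f.symm : C(ShiftSpace n, ShiftSpace n))

theorem letterFn_apply (f : ShiftSpace n ≃ₜ ShiftSpace n) (i : Fin n) (x : ShiftSpace n) :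
    letterFn f i x = if f.symm x 0 = i then 1 else 0 := by
  classical
  change ShiftSpace.cylinderFn [i] (f.symm x) = _
  rw [ShiftSpace.cylinderFn_apply]
  simp [ShiftSpace.mem_cylinder_cons, ShiftSpace.mem_cylinder_nil]

theorem sum_letterFn (f : ShiftSpace n ≃ₜ ShiftSpace n) : ∑ i, letterFn f i = 1 := by
  ext x
  simp [ContinuousMap.sum_apply, letterFn_apply]

theorem letterFn_mul (f : ShiftSpace n ≃ₜ ShiftSpace n) (i : Fin n) :
    letterFn f i * letterFn f i = letterFn f i := by
  ext x
  simp [letterFn_apply]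

theorem star_letterFn (f : ShiftSpace n ≃ₜ ShiftSpace n) (i : Fin n) :
    star (letterFn f i) = letterFn f i := by
  ext x
  simp [letterFn_apply]

theorem symm_shift {f : ShiftSpace n ≃ₜ ShiftSpace n} (hf : f ∈ ShiftSpace.autShift n)
    (x : ShiftSpace n) : f.symm (ShiftSpace.shift x) = ShiftSpace.shift (f.symm x) :=
  inv_mem hf x

/-- The points `jx` form the fibre of the shift over `x`, and `f⁻¹` maps them injectively into the
fibre over `f⁻¹(x)`, whose points are told apart by their first letters. Both fibres have `n`
points. -/
theorem bijective_symm_cons_zero {f : ShiftSpace n ≃ₜ ShiftSpace n}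
    (hf : f ∈ ShiftSpace.autShift n) (x : ShiftSpace n) :
    Function.Bijective fun j => f.symm (ShiftSpace.cons j x) 0 := by
  refine Finite.injective_iff_bijective.1 fun j k h => ?_
  have h2 : ∀ j, f.symm (ShiftSpace.cons j x)
      = ShiftSpace.cons (f.symm (ShiftSpace.cons j x) 0) (f.symm x) := by
    intro j
    rw [ShiftSpace.cons_eq_iff, ← symm_shift hf, ShiftSpace.shift_cons]
    exact ⟨rfl, rfl⟩
  have h3 : f.symm (ShiftSpace.cons j x) = f.symm (ShiftSpace.cons k x) := by
    rw [h2 j, h2 k]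
    exact congrArg (fun i => ShiftSpace.cons i (f.symm x)) h
  exact congrFun (f.symm.injective h3) 0

theorem sum_letterFn_comp_cons {f : ShiftSpace n ≃ₜ ShiftSpace n}
    (hf : f ∈ ShiftSpace.autShift n) (i : Fin n) :
    ∑ j, (letterFn f i).comp (ShiftSpace.consMap j) = 1 := by
  ext x
  obtain ⟨j, hj⟩ := (bijective_symm_cons_zero hf x).2 i
  simp only [ContinuousMap.sum_apply, ContinuousMap.comp_apply, letterFn_apply,
    ContinuousMap.one_apply]
  rw [Finset.sum_eq_single j]
  · exact if_pos hj
  · intro k _ hk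
    exact if_neg fun h => hk ((bijective_symm_cons_zero hf x).1 (h.trans hj.symm))
  · simp

theorem letterFn_comp_cons_mul {f : ShiftSpace n ≃ₜ ShiftSpace n}
    (hf : f ∈ ShiftSpace.autShift n) (i : Fin n) {j k : Fin n} (hjk : j ≠ k) :
    (letterFn f i).comp (ShiftSpace.consMap j) * (letterFn f i).comp (ShiftSpace.consMap k)
      = 0 := by
  ext x
  simp only [ContinuousMap.mul_apply, ContinuousMap.comp_apply, letterFn_apply,
    ContinuousMap.zero_apply]
  by_cases h1 : f.symm (ShiftSpace.consMap j x) 0 = i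
  · have h2 : ¬ f.symm (ShiftSpace.consMap k x) 0 = i := fun h2 =>
      hjk ((bijective_symm_cons_zero hf x).1 (h1.trans h2.symm))
    simp [h2]
  · simp [h1]

variable {ι : C(ShiftSpace n, ℂ) →⋆ₐ[ℂ] CuntzAlgebra n}

section Relations

variable (hι : ∀ μ, ι (ShiftSpace.cylinderFn μ) = rangeProj μ)
include hι

-- The covariance relation behind all later computations. Both sides are linear and continuous in
-- `g`, so it is enough to take `P_μ`, where it follows from `Sⱼ* Sᵢ = δᵢⱼ`.
open scoped CStarAlgebra in
theorem apply_mul_gen (g : C(ShiftSpace n, ℂ)) (i : Fin n) :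
    ι g * gen i = gen i * ι (g.comp (ShiftSpace.consMap i)) := by
  classical
  have hιc : Continuous ι := map_continuous ι
  let A : C(ShiftSpace n, ℂ) →ₗ[ℂ] CuntzAlgebra n :=
    (LinearMap.mulRight ℂ (gen i)).comp ι.toAlgHom.toLinearMap
  let B : C(ShiftSpace n, ℂ) →ₗ[ℂ] CuntzAlgebra n :=
    (LinearMap.mulLeft ℂ (gen i)).comp (ι.toAlgHom.toLinearMap.comp
      (ContinuousMap.compStarAlgHom' ℂ ℂ (ShiftSpace.consMap i)).toAlgHom.toLinearMap)
  have hA : Continuous A := hιc.mul continuous_const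
  have hB : Continuous B :=
    continuous_const.mul (hιc.comp (ContinuousMap.continuous_precomp (ShiftSpace.consMap i)))
  refine DFunLike.congr_fun (ShiftSpace.eq_of_eq_cylinderFn A B hA hB fun μ => ?_) g
  change ι (ShiftSpace.cylinderFn μ) * gen i
    = gen i * ι ((ShiftSpace.cylinderFn μ).comp (ShiftSpace.consMap i))
  cases μ with
  | nil =>
    have h : (ShiftSpace.cylinderFn ([] : List (Fin n))).comp (ShiftSpace.consMap i)
        = ShiftSpace.cylinderFn [] := by
      ext x
      simp [ShiftSpace.cylinderFn_apply, ShiftSpace.mem_cylinder_nil]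
    rw [h, hι, rangeProj_nil, one_mul, mul_one]
  | cons j μ =>
    have h : (ShiftSpace.cylinderFn (j :: μ)).comp (ShiftSpace.consMap i)
        = if i = j then ShiftSpace.cylinderFn μ else 0 := by
      ext x
      split_ifs with hij <;>
        simp [ShiftSpace.cylinderFn_apply, ShiftSpace.mem_cylinder_cons, ShiftSpace.consMap, hij]
    rw [h, hι, rangeProj_cons, mul_assoc]
    split_ifs with hij
    · subst hij
      rw [star_gen_mul_gen_self, mul_one, hι]
    · rw [star_gen_mul_gen_of_ne (Ne.symm hij), map_zero, mul_zero, mul_zero]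

theorem star_gen_mul_apply (g : C(ShiftSpace n, ℂ)) (i : Fin n) :
    star (gen i) * ι g = ι (g.comp (ShiftSpace.consMap i)) * star (gen i) := by
  have h := congrArg star (apply_mul_gen hι (star g) i)
  have hc : star ((star g).comp (ShiftSpace.consMap i)) = g.comp (ShiftSpace.consMap i) := by
    ext x
    simp
  rwa [star_mul, star_mul, map_star, star_star, ← map_star, hc] at h

/-- Compression by `S = ∑ Sⱼ` is the transfer operator of the shift, which sums a function over the
fibres. On `1_[i] ∘ f⁻¹` it gives `1`, which makes the images of the generators isometries. -/
theorem star_genSum_mul_mul_genSum (g : C(ShiftSpace n, ℂ)) :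
    star (genSum n) * ι g * genSum n = ι (∑ j, g.comp (ShiftSpace.consMap j)) := by
  rw [genSum, star_sum, Finset.sum_mul, Finset.sum_mul_sum, map_sum]
  refine Finset.sum_congr rfl fun j _ => ?_
  rw [Finset.sum_eq_single j]
  · rw [mul_assoc, apply_mul_gen hι, ← mul_assoc, star_gen_mul_gen_self, one_mul]
  · intro k _ hk
    rw [mul_assoc, apply_mul_gen hι, ← mul_assoc, star_gen_mul_gen_of_ne hk.symm, zero_mul]
  · simp

theorem genSum_mul (g : C(ShiftSpace n, ℂ)) :
    genSum n * ι g = ι (g.comp (ShiftSpace.shiftMap n)) * genSum n := by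
  rw [genSum, Finset.sum_mul, Finset.mul_sum]
  refine Finset.sum_congr rfl fun j _ => ?_
  rw [apply_mul_gen hι]
  -- Prepending `j` and then shifting is definitionally the identity.
  rfl

/-- The cross terms with `Sⱼ Sₖ*`, `j ≠ k`, vanish because `f⁻¹(jx)` and `f⁻¹(kx)` cannot both begin
with `i`. What remains is the sum of the `Sⱼ Sⱼ*`, which is `1`. -/
theorem letterFn_genSum_range {f : ShiftSpace n ≃ₜ ShiftSpace n}
    (hf : f ∈ ShiftSpace.autShift n) (i : Fin n) :
    ι (letterFn f i) * genSum n * star (ι (letterFn f i) * genSum n) = ι (letterFn f i) := by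
  rw [star_mul, ← map_star, star_letterFn]
  have h : ∀ j k, ι (letterFn f i) * gen j * (star (gen k) * ι (letterFn f i))
      = if j = k then ι (letterFn f i) * (gen j * star (gen j)) else 0 := by
    intro j k
    rw [apply_mul_gen hι, star_gen_mul_apply hι]
    rw [show ∀ a b c d : CuntzAlgebra n, a * b * (c * d) = a * (b * c) * d by
      intros; simp only [mul_assoc], ← map_mul]
    split_ifs with hjk
    · subst hjk
      have : (letterFn f i).comp (ShiftSpace.consMap j) * (letterFn f i).comp (ShiftSpace.consMap j)
          = (letterFn f i * letterFn f i).comp (ShiftSpace.consMap j) := rfl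
      rw [this, letterFn_mul, ← apply_mul_gen hι, mul_assoc]
    · rw [letterFn_comp_cons_mul hf i hjk, map_zero, mul_zero, zero_mul]
  rw [genSum, star_sum, Finset.mul_sum, Finset.sum_mul _ _ (ι (letterFn f i)), Finset.sum_mul_sum]
  simp only [h, Finset.sum_ite_eq, Finset.mem_univ, if_true]
  rw [← Finset.mul_sum, sum_gen_mul_star_gen, mul_one]

theorem sum_letterFn_genSum_range {f : ShiftSpace n ≃ₜ ShiftSpace n}
    (hf : f ∈ ShiftSpace.autShift n) :
    ∑ i, ι (letterFn f i) * genSum n * star (ι (letterFn f i) * genSum n) = 1 := by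
  simp only [letterFn_genSum_range hι hf]
  rw [← map_sum, sum_letterFn, map_one]

theorem star_letterFn_genSum_mul_self {f : ShiftSpace n ≃ₜ ShiftSpace n}
    (hf : f ∈ ShiftSpace.autShift n) (i : Fin n) :
    star (ι (letterFn f i) * genSum n) * (ι (letterFn f i) * genSum n) = 1 := by
  rw [star_mul, ← map_star, star_letterFn, mul_assoc, ← mul_assoc (ι _), ← map_mul, letterFn_mul,
    ← mul_assoc, star_genSum_mul_mul_genSum hι, sum_letterFn_comp_cons hf, map_one]

/-- The endomorphism of `𝒪ₙ` given by a homeomorphism that commutes with the shift. -/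
def shiftEndo (f : ShiftSpace.autShift n) : CuntzAlgebra n →⋆ₐ[ℂ] CuntzAlgebra n :=
  endo (fun i => ι (letterFn f i) * genSum n) (star_letterFn_genSum_mul_self hι f.2)
    (sum_letterFn_genSum_range hι f.2)

theorem shiftEndo_gen (f : ShiftSpace.autShift n) (i : Fin n) :
    shiftEndo hι f (gen i) = ι (letterFn f i) * genSum n := endo_gen _ _ _ i

/-- The functions `1_[i] ∘ f⁻¹` add up to `1`. With `S` fixed, composing two of these endomorphisms
only moves the function factor, whence `shiftEndo_mul`. -/
theorem shiftEndo_genSum (f : ShiftSpace.autShift n) :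
    shiftEndo hι f (genSum n) = genSum n := by
  conv_lhs => rw [genSum]
  rw [map_sum]
  simp only [shiftEndo_gen]
  rw [← Finset.sum_mul, ← map_sum, sum_letterFn, map_one, one_mul]

-- Induction on the word, using `P_{iμ} = Sᵢ P_μ Sᵢ*`: moving `S` past `1_μ ∘ f⁻¹` composes it with
-- the shift, and `f⁻¹ σ = σ f⁻¹` turns the product with `1_[i] ∘ f⁻¹` into `1_{iμ} ∘ f⁻¹`.
open scoped CStarAlgebra in
theorem shiftEndo_apply (f : ShiftSpace.autShift n) (g : C(ShiftSpace n, ℂ)) :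
    shiftEndo hι f (ι g)
      = ι (g.comp ((f : ShiftSpace n ≃ₜ ShiftSpace n).symm : C(ShiftSpace n, ShiftSpace n))) := by
  classical
  have hιc : Continuous ι := map_continuous ι
  let A : C(ShiftSpace n, ℂ) →ₗ[ℂ] CuntzAlgebra n :=
    ((shiftEndo hι f).comp ι).toAlgHom.toLinearMap
  let B : C(ShiftSpace n, ℂ) →ₗ[ℂ] CuntzAlgebra n :=
    (ι.comp (ContinuousMap.compStarAlgHom' ℂ ℂ
      ((f : ShiftSpace n ≃ₜ ShiftSpace n).symm : C(ShiftSpace n, ShiftSpace n)))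
        ).toAlgHom.toLinearMap
  have hA : Continuous A := (map_continuous (shiftEndo hι f)).comp hιc
  have hB : Continuous B := hιc.comp (ContinuousMap.continuous_precomp _)
  refine DFunLike.congr_fun (ShiftSpace.eq_of_eq_cylinderFn A B hA hB fun μ => ?_) g
  change shiftEndo hι f (ι (ShiftSpace.cylinderFn μ)) = ι ((ShiftSpace.cylinderFn μ).comp
    ((f : ShiftSpace n ≃ₜ ShiftSpace n).symm : C(ShiftSpace n, ShiftSpace n)))
  induction μ with
  | nil =>
    have h : (ShiftSpace.cylinderFn ([] : List (Fin n))).comp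
        ((f : ShiftSpace n ≃ₜ ShiftSpace n).symm : C(ShiftSpace n, ShiftSpace n))
        = ShiftSpace.cylinderFn [] := by
      ext x
      simp [ShiftSpace.cylinderFn_apply, ShiftSpace.mem_cylinder_nil]
    rw [h, hι, rangeProj_nil, map_one]
  | cons i μ ih =>
    rw [hι] at ih
    rw [hι, rangeProj_cons, map_mul, map_mul, map_star, ih, shiftEndo_gen, mul_assoc (ι _),
      genSum_mul hι, ← mul_assoc, ← map_mul, mul_comm (letterFn _ _), map_mul, mul_assoc (ι _),
      mul_assoc (ι _), letterFn_genSum_range hι f.2, ← map_mul]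
    congr 1
    ext x
    have hs : (f : ShiftSpace n ≃ₜ ShiftSpace n).symm (ShiftSpace.shiftMap n x)
        = ShiftSpace.shift ((f : ShiftSpace n ≃ₜ ShiftSpace n).symm x) := symm_shift f.2 x
    simp only [ContinuousMap.mul_apply, ContinuousMap.comp_apply, letterFn_apply]
    erw [hs]
    rw [ShiftSpace.cylinderFn_apply, ShiftSpace.cylinderFn_apply, ShiftSpace.mem_cylinder_cons]
    have hc : ((f : ShiftSpace n ≃ₜ ShiftSpace n).symm : C(ShiftSpace n, ShiftSpace n)) x
        = (f : ShiftSpace n ≃ₜ ShiftSpace n).symm x := rfl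
    rw [hc]
    by_cases h1 : (f : ShiftSpace n ≃ₜ ShiftSpace n).symm x 0 = i <;> simp [h1]

theorem shiftEndo_mul (f g : ShiftSpace.autShift n) :
    shiftEndo hι (f * g) = (shiftEndo hι f).comp (shiftEndo hι g) := by
  refine hom_ext fun i => ?_
  rw [StarAlgHom.comp_apply, shiftEndo_gen, shiftEndo_gen, map_mul, shiftEndo_genSum,
    shiftEndo_apply]
  rfl

theorem shiftEndo_one : shiftEndo hι 1 = StarAlgHom.id ℂ (CuntzAlgebra n) := by
  refine hom_ext fun i => ?_
  have h : ι (letterFn (1 : ShiftSpace n ≃ₜ ShiftSpace n) i) = gen i * star (gen i) := by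
    have : letterFn (1 : ShiftSpace n ≃ₜ ShiftSpace n) i = ShiftSpace.cylinderFn [i] := rfl
    rw [this, hι, rangeProj_cons, rangeProj_nil, mul_one]
  rw [shiftEndo_gen]
  change ι (letterFn (1 : ShiftSpace n ≃ₜ ShiftSpace n) i) * genSum n = gen i
  rw [h, genSum, Finset.mul_sum, Finset.sum_eq_single i]
  · rw [mul_assoc, star_gen_mul_gen_self, mul_one]
  · intro j _ hj
    rw [mul_assoc, star_gen_mul_gen_of_ne hj.symm, mul_zero]
  · simp

/-- The action of `Aut(Xₙ)` on `𝒪ₙ`. -/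
def shiftAut : ShiftSpace.autShift n →* Aut n where
  toFun f := StarAlgEquiv.ofStarAlgHom (shiftEndo hι f) (shiftEndo hι f⁻¹)
    (by rw [← shiftEndo_mul, inv_mul_cancel, shiftEndo_one])
    (by rw [← shiftEndo_mul, mul_inv_cancel, shiftEndo_one])
  map_one' := by
    ext x
    exact DFunLike.congr_fun (shiftEndo_one hι) x
  map_mul' f g := by
    ext x
    exact DFunLike.congr_fun (shiftEndo_mul hι f g) x

theorem shiftAut_gen (f : ShiftSpace.autShift n) (i : Fin n) :
    shiftAut hι f (gen i) = ι (letterFn f i) * genSum n := shiftEndo_gen hι f i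

theorem shiftAut_apply (f : ShiftSpace.autShift n) (g : C(ShiftSpace n, ℂ)) :
    shiftAut hι f (ι g)
      = ι (g.comp ((f : ShiftSpace n ≃ₜ ShiftSpace n).symm : C(ShiftSpace n, ShiftSpace n))) :=
  shiftEndo_apply hι f g

theorem exists_list_sum_rangeProj (f : ShiftSpace n ≃ₜ ShiftSpace n) (i : Fin n) :
    ∃ L : List (List (Fin n)), ι (letterFn f i) = (L.map rangeProj).sum := by
  obtain ⟨L, hL⟩ := ShiftSpace.exists_list_sum_cylinderFn
    ((ShiftSpace.isClopen_cylinder [i]).preimage f.symm.continuous)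
  refine ⟨L, ?_⟩
  have : letterFn f i = (L.map ShiftSpace.cylinderFn).sum := by
    classical
    ext x
    rw [hL, letterFn_apply]
    simp [Set.indicator_apply, ShiftSpace.mem_cylinder_cons, ShiftSpace.mem_cylinder_nil]
  rw [this, map_list_sum, List.map_map]
  congr 2
  ext μ
  exact hι μ

/-- Every automorphism `α` is `λ_u` with `u = ∑ α(Sᵢ) Sᵢ*`. Here `u` is the sum of all `ι(1_[i] ∘
f⁻¹) Sⱼ Sᵢ*`, and the first factor is a finite sum of projections `P_μ` because the preimage of a
cylinder is clopen; so `u` is a sum of words and lies in the core. -/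
theorem isPermutative_shiftAut (f : ShiftSpace.autShift n) : IsPermutative (shiftAut hι f) := by
  let α := shiftAut hι f
  have hstar : ∀ i j, star (α (gen i)) * α (gen j) = if i = j then 1 else 0 := by
    intro i j
    rw [← map_star, ← map_mul]
    split_ifs with hij
    · subst hij
      rw [star_gen_mul_gen_self, map_one]
    · rw [star_gen_mul_gen_of_ne hij, map_zero]
  let u : CuntzAlgebra n := ∑ i, α (gen i) * star (gen i)
  have hu : u ∈ unitary (CuntzAlgebra n) := by
    rw [Unitary.mem_iff]
    constructor
    · simp only [u, star_sum, star_mul, star_star]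
      rw [Finset.sum_mul_sum, ← sum_gen_mul_star_gen]
      refine Finset.sum_congr rfl fun i _ => ?_
      rw [Finset.sum_eq_single i]
      · rw [mul_assoc, ← mul_assoc (star _), hstar, if_pos rfl, one_mul]
      · intro j _ hj
        rw [mul_assoc, ← mul_assoc (star _), hstar, if_neg hj.symm, zero_mul, mul_zero]
      · simp
    · simp only [u, star_sum, star_mul, star_star]
      rw [Finset.sum_mul_sum, ← map_one α, ← sum_gen_mul_star_gen, map_sum]
      refine Finset.sum_congr rfl fun i _ => ?_
      rw [Finset.sum_eq_single i]
      · rw [mul_assoc, ← mul_assoc (star _), star_gen_mul_gen_self, one_mul, map_mul, map_star]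
      · intro j _ hj
        rw [mul_assoc, ← mul_assoc (star _), star_gen_mul_gen_of_ne hj.symm, zero_mul, mul_zero]
      · simp
  have hα : ∀ i, α (gen i) * star (gen i) = ∑ j, ι (letterFn f i) * (gen j * star (gen i)) := by
    intro i
    rw [shiftAut_gen, genSum, Finset.mul_sum, Finset.sum_mul]
    simp only [mul_assoc]
  refine ⟨⟨u, hu⟩, ⟨?_, ?_⟩, fun i => ?_⟩
  · change IsWordSum (∑ i, α (gen i) * star (gen i))
    refine isWordSum_finset_sum _ _ fun i _ => ?_
    rw [hα]
    refine isWordSum_finset_sum _ _ fun j _ => IsWordSum.mul ?_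
      ((isWordSum_gen j).mul (isWordSum_gen i).star)
    obtain ⟨L, hL⟩ := exists_list_sum_rangeProj hι f i
    rw [hL]
    refine isWordSum_list_sum _ fun x hx => ?_
    obtain ⟨μ, -, rfl⟩ := List.mem_map.1 hx
    exact isWordSum_word μ μ
  · change (∑ i, α (gen i) * star (gen i)) ∈ core n
    refine sum_mem fun i _ => ?_
    rw [hα]
    refine sum_mem fun j _ => mul_mem ?_ ?_
    · obtain ⟨L, hL⟩ := exists_list_sum_rangeProj hι f i
      rw [hL]
      refine list_sum_mem fun x hx => ?_
      obtain ⟨μ, -, rfl⟩ := List.mem_map.1 hx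
      exact word_mem_core rfl
    · have := word_mem_core (μ := [j]) (ν := [i]) rfl
      simpa [word_cons, word_nil] using this
  · change α (gen i) = u * gen i
    simp only [u]
    rw [Finset.sum_mul, Finset.sum_eq_single i]
    · rw [mul_assoc, star_gen_mul_gen_self, mul_one]
    · intro j _ hj
      rw [mul_assoc, star_gen_mul_gen_of_ne hj, mul_zero]
    · simp

theorem shiftAut_mem (f : ShiftSpace.autShift n) : shiftAut hι f ∈ restrictedWeyl n :=
  ⟨isPermutative_shiftAut hι f, by rw [← map_inv]; exact isPermutative_shiftAut hι f⁻¹⟩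

end Relations

end CuntzAlgebra

/-! ### Word sums that commute with the diagonal. -/

namespace CuntzAlgebra

variable {n : ℕ} {I : Type} {ι : C(ShiftSpace n, ℂ) →⋆ₐ[ℂ] CuntzAlgebra n}

open EllTwo

section Rep

variable [Nonempty I] (hι : ∀ μ, ι (ShiftSpace.cylinderFn μ) = rangeProj μ)
  (e : Fin n × I ≃ I) {c : I → ShiftSpace n}
  (hc : ∀ i y, c (e (i, y)) = ShiftSpace.cons i (c y))
include hι hc

open scoped CStarAlgebra in
theorem rep_apply_basisVec (g : C(ShiftSpace n, ℂ)) (y : I) :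
    rep e (ι g) (basisVec y) = g (c y) • basisVec y := by
  have hιc : Continuous ι := map_continuous ι
  have hrc : Continuous (rep e) := map_continuous (rep e)
  let A : C(ShiftSpace n, ℂ) →ₗ[ℂ] EllTwo I :=
    (ContinuousLinearMap.apply ℂ (EllTwo I) (basisVec y)).toLinearMap.comp
      ((rep e).comp ι).toAlgHom.toLinearMap
  let B : C(ShiftSpace n, ℂ) →ₗ[ℂ] EllTwo I :=
    (LinearMap.toSpanSingleton ℂ _ (basisVec y)).comp
      (ContinuousMap.evalCLM ℂ (c y)).toLinearMap
  have hA : Continuous A :=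
    (ContinuousLinearMap.apply ℂ (EllTwo I) (basisVec y)).continuous.comp (hrc.comp hιc)
  have hB : Continuous B := (ContinuousMap.evalCLM ℂ (c y)).continuous.smul continuous_const
  refine DFunLike.congr_fun (ShiftSpace.eq_of_eq_cylinderFn A B hA hB fun μ => ?_) g
  change rep e (ι (ShiftSpace.cylinderFn μ)) (basisVec y)
    = ShiftSpace.cylinderFn μ (c y) • basisVec y
  rw [hι, rep_rangeProj e hc]

theorem rep_apply_apply (g : C(ShiftSpace n, ℂ)) (ξ : EllTwo I) (y : I) :
    rep e (ι g) ξ y = g (c y) * ξ y := by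
  have h : rep e (ι g) = ContinuousLinearMap.adjoint (rep e (ι (star g))) := by
    rw [← ContinuousLinearMap.star_eq_adjoint, ← map_star, ← map_star, star_star]
  rw [← inner_basisVec, h, ContinuousLinearMap.adjoint_inner_right,
    rep_apply_basisVec hι e hc, inner_smul_left, inner_basisVec]
  simp

/-- A vector in the spectral subspace of a point. -/
theorem apply_eq_zero_of_forall_rep {ξ : EllTwo I} {x : ShiftSpace n}
    (h : ∀ g, rep e (ι g) ξ = g x • ξ) {y : I} (hy : c y ≠ x) : ξ y = 0 := by
  classical
  obtain ⟨k, hk⟩ := ShiftSpace.exists_cylinder_subset isOpen_ne hy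
  have hx : x ∉ ShiftSpace.cylinder (ShiftSpace.pre (c y) k) := fun hx => hk hx rfl
  have h1 := congrArg (fun η : EllTwo I => η y)
    (h (ShiftSpace.cylinderFn (ShiftSpace.pre (c y) k)))
  simp only [rep_apply_apply hι e hc] at h1
  simpa [ShiftSpace.cylinderFn_apply, hx, ShiftSpace.mem_cylinder_iff] using h1

end Rep

theorem rep_word (μ : List (Fin n)) (x : ShiftSpace n) [Nonempty (ShiftSpace n)] :
    rep (consEquiv n) (word μ) (basisVec x) = basisVec (ShiftSpace.append μ x) := by
  induction μ with
  | nil => simp [word_nil]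
  | cons i μ ih =>
    rw [word_cons, map_mul, mul_apply_eq_comp, ih, rep_gen, repGen_basisVec]
    rfl

/-- Once `ν` is at least as long as every `β` in the terms `S_α S_β*` of `w`, each `S_β* S_ν` is `0`
or a word, and no adjoint is left. -/
theorem exists_mul_word {w : CuntzAlgebra n} (hw : IsWordSum w) :
    ∃ k, ∀ ν : List (Fin n), k ≤ ν.length →
      ∃ M : List (List (Fin n)), w * word ν = (M.map word).sum := by
  obtain ⟨L, rfl⟩ := hw
  induction L with
  | nil => exact ⟨0, fun ν _ => ⟨[], by simp⟩⟩
  | cons p L ih =>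
    obtain ⟨k, hk⟩ := ih
    refine ⟨max k p.2.length, fun ν hν => ?_⟩
    obtain ⟨M, hM⟩ := hk ν ((le_max_left _ _).trans hν)
    have h : ∀ (α β : List (Fin n)), α.length ≤ β.length →
        star (word α) * word β = 0 ∨ ∃ γ, star (word α) * word β = word γ := by
      intro α
      induction α with
      | nil => exact fun β _ => Or.inr ⟨β, by simp [word_nil]⟩
      | cons i α ih =>
        intro β hβ
        cases β with
        | nil => simp at hβ
        | cons j β =>
          have h : star (word (i :: α)) * word (j :: β)
              = star (word α) * (star (gen i) * gen j) * word β := by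
            simp [word_cons, mul_assoc]
          rw [h]
          by_cases hij : i = j
          · subst hij
            rw [star_gen_mul_gen_self, mul_one]
            exact ih β (by simpa using hβ)
          · left
            rw [star_gen_mul_gen_of_ne hij]
            simp
    rw [List.map_cons, List.sum_cons, add_mul, hM]
    rcases h p.2 ν ((le_max_right _ _).trans hν) with h | ⟨γ, h⟩
    · exact ⟨M, by rw [mul_assoc, h, mul_zero, zero_add]⟩
    · exact ⟨(p.1 ++ γ) :: M, by
        rw [mul_assoc, h, ← word_append, List.map_cons, List.sum_cons]⟩

theorem sum_rangeProj_ofFn (k : ℕ) :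
    ∑ v : Fin k → Fin n, rangeProj (List.ofFn v) = (1 : CuntzAlgebra n) := by
  induction k with
  | zero => simp [rangeProj_nil]
  | succ k ih =>
    rw [← (Fin.consEquiv fun _ => Fin n).sum_comp, Fintype.sum_prod_type,
      ← sum_gen_mul_star_gen]
    refine Finset.sum_congr rfl fun i _ => ?_
    have h : ∀ v : Fin k → Fin n, rangeProj (List.ofFn (Fin.consEquiv (fun _ => Fin n) (i, v)))
        = gen i * rangeProj (List.ofFn v) * star (gen i) := by
      intro v
      rw [← rangeProj_cons, List.ofFn_succ]
      rfl
    rw [Finset.sum_congr rfl fun v _ => h v, ← Finset.sum_mul, ← Finset.mul_sum, ih, mul_one]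

theorem append_injective (hn : 2 ≤ n) {μ ν : List (Fin n)}
    (h : ∀ x : ShiftSpace n, ShiftSpace.append μ x = ShiftSpace.append ν x) : μ = ν := by
  -- A nonempty `γ` prescribes the first letter of `γx`, which contradicts the existence of constant
  -- sequences in two different letters.
  have key : ∀ γ : List (Fin n), (∀ x : ShiftSpace n, x = ShiftSpace.append γ x) → γ = [] := by
    intro γ hγ
    cases γ with
    | nil => rfl
    | cons i γ =>
      have h0 : ∀ j : Fin n, j = i := fun j => congrFun (hγ fun _ => j) 0
      have h1 := (h0 ⟨0, by omega⟩).trans (h0 ⟨1, by omega⟩).symm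
      simp at h1
  induction μ generalizing ν with
  | nil => exact (key ν h).symm
  | cons i μ ih =>
    cases ν with
    | nil => exact key _ fun x => (h x).symm
    | cons j ν =>
      have hij : i = j := congrFun (h fun _ => i) 0
      rw [ih fun x => congrArg ShiftSpace.shift (h x), hij]

/-- A unitary finite sum of words that commutes with the diagonal is trivial. -/
theorem eq_one_of_commute (hn : 2 ≤ n)
    (hι : ∀ μ, ι (ShiftSpace.cylinderFn μ) = rangeProj μ) {w : CuntzAlgebra n}
    (hw : IsWordSum w) (hu : star w * w = 1) (hcomm : ∀ g, ι g * w = w * ι g) : w = 1 := by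
  have : NeZero n := ⟨by omega⟩
  let π := rep (consEquiv n)
  have hc : ∀ (i : Fin n) (y : ShiftSpace n), id (consEquiv n (i, y)) = ShiftSpace.cons i (id y) :=
    fun _ _ => rfl
  -- As `w` commutes with the diagonal, `w δ_x` is an eigenvector with the character `x`, and in
  -- `ℓ²(Xₙ)` only multiples of `δ_x` are such.
  have hsupp : ∀ x y : ShiftSpace n, y ≠ x → π w (basisVec x) y = 0 := by
    intro x y hxy
    refine apply_eq_zero_of_forall_rep hι (consEquiv n) hc (x := x) (fun g => ?_) hxy
    change (π (ι g) * π w) (basisVec x) = _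
    rw [← map_mul, hcomm, map_mul, mul_apply_eq_comp,
      rep_apply_basisVec hι (consEquiv n) hc, map_smul]
    rfl
  obtain ⟨k, hk⟩ := exists_mul_word hw
  have hword : ∀ ν : List (Fin n), k ≤ ν.length → w * word ν = word ν := by
    intro ν hν
    obtain ⟨M, hM⟩ := hk ν hν
    have hx : ∀ x : ShiftSpace n, π w (basisVec (ShiftSpace.append ν x))
        = (M.map fun μ => basisVec (ShiftSpace.append μ x)).sum := by
      intro x
      rw [← rep_word, ← mul_apply_eq_comp, ← map_mul, hM]
      clear hM
      induction M with
      | nil => simp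
      | cons μ M ih =>
        rw [List.map_cons, List.sum_cons, map_add, add_apply, ih, rep_word,
          List.map_cons, List.sum_cons]
    classical
    -- The coefficients count words, so there is no cancellation: every `μ` in `M` contributes to
    -- the support, which forces `μx = νx`.
    have hval : ∀ (M : List (List (Fin n))) (x z : ShiftSpace n),
        (M.map fun μ => basisVec (ShiftSpace.append μ x)).sum z
          = ((M.countP fun μ => decide (z = ShiftSpace.append μ x) : ℕ) : ℂ) := by
      intro M x z
      induction M with
      | nil => simp
      | cons μ M ih =>
        rw [List.map_cons, List.sum_cons, lp.coeFn_add, Pi.add_apply, ih, basisVec_apply,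
          List.countP_cons]
        by_cases h : z = ShiftSpace.append μ x <;> simp [h, add_comm]
    have hmem : ∀ μ ∈ M, μ = ν := by
      intro μ hμ
      refine append_injective hn fun x => ?_
      by_contra hne
      have h0 := hsupp (ShiftSpace.append ν x) (ShiftSpace.append μ x) hne
      rw [hx, hval, Nat.cast_eq_zero, List.countP_eq_zero] at h0
      simpa using h0 μ hμ
    -- Now `w S_ν = m S_ν` with `m` the length of `M`. Since `w S_ν` is an isometry, `m * m = 1` and
    -- `m = 1`.
    rw [List.eq_replicate_of_mem hmem, List.map_replicate, List.sum_replicate] at hM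
    have hsq : star (w * word ν) * (w * word ν) = 1 := by
      rw [star_mul, mul_assoc, ← mul_assoc (star w), hu, one_mul, star_word_mul_self]
    have := nontrivial_of_ne_zero (n := n) (by omega)
    have : CharZero (CuntzAlgebra n) :=
      charZero_of_injective_algebraMap (algebraMap ℂ (CuntzAlgebra n)).injective
    rw [hM, star_nsmul, smul_mul_smul_comm, star_word_mul_self, nsmul_one,
      Nat.cast_eq_one] at hsq
    rw [hM, Nat.eq_one_of_mul_eq_one_left hsq, one_smul]
  calc w = w * ∑ v : Fin k → Fin n, rangeProj (List.ofFn v) := by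
        rw [sum_rangeProj_ofFn, mul_one]
    _ = ∑ v : Fin k → Fin n, rangeProj (List.ofFn v) := by
        rw [Finset.mul_sum]
        refine Finset.sum_congr rfl fun v _ => ?_
        rw [rangeProj, ← mul_assoc, hword _ (by simp)]
    _ = 1 := sum_rangeProj_ofFn k

end CuntzAlgebra

/-! ### Tail equivalence and shift automorphisms. -/

namespace ShiftSpace

variable {n : ℕ}

/-- The sequences that are tail equivalent (with lag) to `x`. -/
abbrev TailClass (x : ShiftSpace n) : Type :=
  {y : ShiftSpace n // ∃ k l : ℕ, shift^[k] y = shift^[l] x}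

/-- The bijection `(i, y) ↦ iy` of a tail equivalence class. -/
def tailEquiv (x : ShiftSpace n) : Fin n × TailClass x ≃ TailClass x where
  toFun p := ⟨cons p.1 p.2, by
    obtain ⟨k, l, h⟩ := p.2.2
    exact ⟨k + 1, l, h⟩⟩
  invFun y := (y.1 0, ⟨shift y.1, by
    obtain ⟨k, l, h⟩ := y.2
    refine ⟨k, l + 1, ?_⟩
    rw [← Function.iterate_succ_apply, Function.iterate_succ_apply', Function.iterate_succ_apply',
      h]⟩)
  left_inv p := by simp
  right_inv y := by simp

theorem shift_iterate_surjective (hn : n ≠ 0) (k : ℕ) :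
    Function.Surjective (shift^[k] : ShiftSpace n → ShiftSpace n) :=
  Function.Surjective.iterate (fun x => ⟨cons ⟨0, Nat.pos_of_ne_zero hn⟩ x, rfl⟩) k

theorem not_injective_shift_iterate (hn : 2 ≤ n) (d : ℕ) :
    ¬ Function.Injective (shift^[d + 1] : ShiftSpace n → ShiftSpace n) := by
  intro h
  let i : Fin n := ⟨0, by omega⟩
  let j : Fin n := ⟨1, by omega⟩
  have h1 : cons i (fun _ => i) = cons j (fun _ => i) := h rfl
  have h2 : i = j := congrFun h1 0
  simp [i, j] at h2

theorem apply_shift_iterate {f : ShiftSpace n ≃ₜ ShiftSpace n} (hf : f ∈ autShift n) (k : ℕ)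
    (x : ShiftSpace n) : f (shift^[k] x) = shift^[k] (f x) := by
  induction k generalizing x with
  | zero => rfl
  | succ k ih => rw [Function.iterate_succ_apply, ih, hf, ← Function.iterate_succ_apply]

/-- A homeomorphism that commutes with the shift and respects tail equivalence classes
is trivial. -/
theorem eq_one_of_tail (hn : 2 ≤ n) (f : autShift n)
    (h : ∀ x : ShiftSpace n, ∃ k l : ℕ, shift^[k] ((f : ShiftSpace n ≃ₜ ShiftSpace n) x)
      = shift^[l] x) : f = 1 := by
  obtain ⟨f, hf⟩ := f
  have : NeZero n := ⟨by omega⟩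
  -- Baire's theorem: the compact space is a countable union of closed sets, one for each pair of
  -- lags, so one of them has interior.
  obtain ⟨⟨k, l⟩, x, hx⟩ := nonempty_interior_of_iUnion_of_closed
    (f := fun p : ℕ × ℕ => {x : ShiftSpace n | shift^[p.1] (f x) = shift^[p.2] x})
    (fun p => isClosed_eq ((continuous_shift.iterate _).comp f.continuous)
      (continuous_shift.iterate _))
    (Set.eq_univ_of_forall fun x => by
      obtain ⟨k, l, hkl⟩ := h x
      exact Set.mem_iUnion.2 ⟨(k, l), hkl⟩)
  obtain ⟨m, hm⟩ := exists_cylinder_subset isOpen_interior hx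
  -- The relation holds on a cylinder of length `m`, which `shift^[m]` maps onto the whole space.
  -- Applying `shift^[m]`, which commutes with `f`, spreads it everywhere.
  have hkl : ∀ z, f (shift^[k] z) = shift^[l] z := by
    intro z
    have h0 := interior_subset (hm (append_mem_cylinder (pre x m) z))
    have h1 : shift^[k] (f (append (pre x m) z)) = shift^[l] (append (pre x m) z) := h0
    have h2 := congrArg (shift^[m]) h1
    have h3 : shift^[m] (append (pre x m) z) = z := by
      simpa using shift_iterate_append (pre x m) z
    rw [← Function.iterate_add_apply, ← Function.iterate_add_apply, add_comm m, add_comm m,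
      Function.iterate_add_apply, Function.iterate_add_apply, ← apply_shift_iterate hf, h3] at h2
    rw [apply_shift_iterate hf, h2]
  have hn0 : n ≠ 0 := by omega
  rcases le_or_gt k l with hle | hlt
  · obtain ⟨d, rfl⟩ := Nat.exists_eq_add_of_le hle
    -- Surjectivity of `shift^[k]` cancels the common lag. Then `f` is a power of the shift,
    -- injective only for exponent `0`.
    have hd : ∀ z, f z = shift^[d] z := by
      intro z
      obtain ⟨w, rfl⟩ := shift_iterate_surjective hn0 k z
      rw [hkl, add_comm, Function.iterate_add_apply]
    cases d with
    | zero =>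
      apply Subtype.ext
      ext1 z
      exact hd z
    | succ d =>
      refine absurd ?_ (not_injective_shift_iterate hn d)
      rw [← funext hd]
      exact f.injective
  · obtain ⟨d, rfl⟩ := Nat.exists_eq_add_of_lt hlt
    refine absurd ?_ (not_injective_shift_iterate hn d)
    -- With the larger lag on the side of `f`, a positive power of the shift acquires a left
    -- inverse, which is impossible.
    have hd : ∀ z, f (shift^[d + 1] z) = z := by
      intro z
      obtain ⟨w, rfl⟩ := shift_iterate_surjective hn0 l z
      rw [← Function.iterate_add_apply, show d + 1 + l = l + d + 1 by omega, hkl]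
    exact Function.LeftInverse.injective hd

end ShiftSpace

/-! ### Uniqueness of the extension and outerness. -/

namespace CuntzAlgebra

variable {n : ℕ} {ι : C(ShiftSpace n, ℂ) →⋆ₐ[ℂ] CuntzAlgebra n}

open EllTwo

/-- A permutative automorphism that fixes the diagonal is trivial. -/
theorem eq_one_of_fixes (hn : 2 ≤ n) (hι : ∀ μ, ι (ShiftSpace.cylinderFn μ) = rangeProj μ)
    {γ : Aut n} (hγ : IsPermutative γ) (hfix : ∀ g, γ (ι g) = ι g) : γ = 1 := by
  obtain ⟨u, hu, hγu⟩ := hγ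
  have hletter : ∀ (g : C(ShiftSpace n, ℂ)) (i : Fin n),
      ι (g * ShiftSpace.cylinderFn [i]) * u = u * ι (g * ShiftSpace.cylinderFn [i]) := by
    intro g i
    have h1 : ι (g * ShiftSpace.cylinderFn [i])
        = gen i * ι (g.comp (ShiftSpace.consMap i)) * star (gen i) := by
      rw [map_mul, hι, rangeProj_cons, rangeProj_nil, mul_one, ← mul_assoc, apply_mul_gen hι]
    -- Apply `γ` to `Sᵢ ι(g(i·)) Sᵢ*`: both outer factors acquire `u` and the middle one is fixed,
    -- so conjugation by `u` leaves the element unchanged.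
    have h2 : ι (g * ShiftSpace.cylinderFn [i])
        = u * ι (g * ShiftSpace.cylinderFn [i]) * star (u : CuntzAlgebra n) := by
      conv_lhs => rw [← hfix, h1, map_mul, map_mul, map_star, hfix, hγu, star_mul]
      rw [h1]
      simp only [mul_assoc]
    conv_lhs => rw [h2, mul_assoc, Unitary.coe_star_mul_self, mul_one]
  have hsum : ∑ i : Fin n, ShiftSpace.cylinderFn [i] = 1 :=
    sum_letterFn (1 : ShiftSpace n ≃ₜ ShiftSpace n)
  have hcomm : ∀ g, ι g * u = u * ι g := by
    intro g
    have hg : g = ∑ i : Fin n, g * ShiftSpace.cylinderFn [i] := by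
      rw [← Finset.mul_sum, hsum, mul_one]
    rw [hg, map_sum, Finset.sum_mul, Finset.mul_sum]
    exact Finset.sum_congr rfl fun i _ => hletter g i
  have h1 := eq_one_of_commute hn hι hu.1 (Unitary.coe_star_mul_self u) hcomm
  exact aut_ext fun i => by rw [hγu, h1, one_mul]; rfl

/-- The automorphism `β_f⁻¹ β` is permutative and fixes the diagonal, so `eq_one_of_fixes` applies.
-/
theorem eq_shiftAut (hn : 2 ≤ n) (hι : ∀ μ, ι (ShiftSpace.cylinderFn μ) = rangeProj μ)
    (f : ShiftSpace.autShift n) {β : Aut n} (hβ : IsPermutative β)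
    (hext : ∀ g, β (ι g) = ι (g.comp
      ((f : ShiftSpace n ≃ₜ ShiftSpace n).symm : C(ShiftSpace n, ShiftSpace n)))) :
    β = shiftAut hι f := by
  have h : (shiftAut hι f)⁻¹ * β = 1 := by
    refine eq_one_of_fixes hn hι ((shiftAut_mem hι f).2.mul hβ) fun g => ?_
    rw [StarAlgEquiv.mul_apply, hext, ← shiftAut_apply hι, ← StarAlgEquiv.mul_apply,
      inv_mul_cancel, StarAlgEquiv.one_apply]
  exact (inv_mul_eq_one.1 h).symm

/-- For each `x`, the representation on the tail class of `x` sees only points tail equivalent to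
`x`. A unitary implementing `β_f` carries `δ_x` to an eigenvector with the character `f(x)`, so
`f(x)` must be one of them. -/
theorem eq_one_of_shiftAut_eq_Ad (hn : 2 ≤ n)
    (hι : ∀ μ, ι (ShiftSpace.cylinderFn μ) = rangeProj μ) (f : ShiftSpace.autShift n)
    (u : unitary (CuntzAlgebra n)) (h : shiftAut hι f = Ad u) : f = 1 := by
  refine ShiftSpace.eq_one_of_tail hn f fun x => ?_
  let f' : ShiftSpace n ≃ₜ ShiftSpace n := f
  let e := ShiftSpace.tailEquiv x
  let x₀ : ShiftSpace.TailClass x := ⟨x, 0, 0, rfl⟩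
  have : Nonempty (ShiftSpace.TailClass x) := ⟨x₀⟩
  have hc : ∀ (i : Fin n) (y : ShiftSpace.TailClass x),
      ((e (i, y) : ShiftSpace.TailClass x) : ShiftSpace n) = ShiftSpace.cons i y := fun _ _ => rfl
  let ξ := rep e u (basisVec x₀)
  have hξ : ∀ g, rep e (ι g) ξ = g (f' x) • ξ := by
    intro g
    let g' : C(ShiftSpace n, ℂ) := g.comp (f' : C(ShiftSpace n, ShiftSpace n))
    have hg : g = g'.comp (f'.symm : C(ShiftSpace n, ShiftSpace n)) := by
      ext y
      exact congrArg g (f'.apply_symm_apply y).symm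
    have h1 : ι g * u = u * ι g' := by
      conv_lhs => rw [hg]
      rw [← shiftAut_apply hι f g', h, Unitary.conjStarAlgAut_apply, mul_assoc,
        Unitary.coe_star_mul_self, mul_one]
    change rep e (ι g) (rep e u (basisVec x₀)) = _
    rw [← mul_apply_eq_comp, ← map_mul, h1, map_mul, mul_apply_eq_comp,
      rep_apply_basisVec hι e hc, map_smul]
    rfl
  by_contra hcon
  -- A nonzero coordinate of `ξ` could occur only at `f(x)`, which by assumption does not belong to
  -- the class.
  have hzero : ξ = 0 := by
    ext y
    refine apply_eq_zero_of_forall_rep hι e hc hξ fun hy => hcon ?_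
    have := y.2
    rwa [hy] at this
  have h1 : rep e (star (u : CuntzAlgebra n)) ξ = basisVec x₀ := by
    change rep e (star (u : CuntzAlgebra n)) (rep e u (basisVec x₀)) = _
    rw [← mul_apply_eq_comp, ← map_mul, Unitary.coe_star_mul_self, map_one, one_apply_eq_self]
  rw [hzero, map_zero] at h1
  have h2 := norm_basisVec x₀
  rw [← h1, norm_zero] at h2
  exact zero_ne_one h2

end CuntzAlgebra

end

/-! ### The main theorem. -/

theorem theorem4p3 (n : ℕ) (hn : 2 ≤ n) :
    ∃ Φ : C(ShiftSpace n, ℂ) ≃⋆ₐ[ℂ] CuntzAlgebra.diagonal n,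
      IsNaturalIdentification Φ ∧
      (∀ f : ShiftSpace.autShift n,
        ∃ β : CuntzAlgebra.restrictedWeyl n, Extends Φ f β ∧
          (∀ β' : CuntzAlgebra.Aut n,
            CuntzAlgebra.IsPermutative β' → Extends Φ f β' → β' = β) ∧
          (f ≠ 1 → CuntzAlgebra.IsOuter (β : CuntzAlgebra.Aut n))) ∧
      ∃ Ψ : ShiftSpace.autShift n →* CuntzAlgebra.RestrictedOuterWeyl n,
        Function.Injective Ψ ∧
        ∀ (f : ShiftSpace.autShift n) (β : CuntzAlgebra.restrictedWeyl n),
          Extends Φ f β → Ψ f = QuotientGroup.mk β := by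
  have := CuntzAlgebra.nontrivial_of_ne_zero (n := n) (by omega)
  obtain ⟨Φ, hΦ⟩ := CuntzAlgebra.exists_isNaturalIdentification (n := n)
  let ι : C(ShiftSpace n, ℂ) →⋆ₐ[ℂ] CuntzAlgebra n :=
    (CuntzAlgebra.diagonal n).subtype.comp (Φ : C(ShiftSpace n, ℂ) →⋆ₐ[ℂ] CuntzAlgebra.diagonal n)
  have hι : ∀ μ, ι (ShiftSpace.cylinderFn μ) = CuntzAlgebra.rangeProj μ := hΦ
  let Λ : ShiftSpace.autShift n →* CuntzAlgebra.restrictedWeyl n :=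
    (CuntzAlgebra.shiftAut hι).codRestrict _ (CuntzAlgebra.shiftAut_mem hι)
  refine ⟨Φ, hΦ, fun f => ⟨Λ f, CuntzAlgebra.shiftAut_apply hι f,
    fun β' hβ' hext => CuntzAlgebra.eq_shiftAut hn hι f hβ' hext,
    fun hf u hu => hf (CuntzAlgebra.eq_one_of_shiftAut_eq_Ad hn hι f u hu)⟩,
    (QuotientGroup.mk' _).comp Λ, ?_, fun f β hext => ?_⟩
  · rw [injective_iff_map_eq_one]
    intro f hf
    -- An element of the kernel is inner, and outerness excludes every unitary of `𝒪ₙ`, so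
    -- membership of `u` in `𝒫ₙ` can be dropped.
    obtain ⟨u, -, hu⟩ := (QuotientGroup.eq_one_iff (Λ f)).1 hf
    exact CuntzAlgebra.eq_one_of_shiftAut_eq_Ad hn hι f u hu.symm
  · have : β = Λ f := Subtype.ext (CuntzAlgebra.eq_shiftAut hn hι f β.2.1 hext)
    rw [this]
    rfl
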